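/- **Conventions.** Let $k$ be a commutative ring. A *balanced oriented quantum algebra* is a $k$-algebra $A$ with an invertible $\rho\in A\otimes A$ and an algebra automorphism $T$ of $A$ such that $\rho_{12}\rho_{13}\rho_{23}=\rho_{23}\rho_{13}\rho_{12}$, $(T\otimes T)\rho=\rho$, and $(1\otimes T)\rho$ and $(T\otimes 1)\rho^{-1}$ are mutually inverse in $A\otimes A^{op}$. Oriented link diagrams are in Morse position: they are composed of oriented cups (minima), caps (maxima) and crossings at different heights. *Regular isotopy* is the equivalence relation generated by planar isotopy (exchange of heights of distant critical points, cancellation of a maximum with a minimum), the switchback moves (a strand passes over or under a maximum or a minimum) and the Reidemeister moves 2 and 3, with all orientations. Given an invertible $M\in M_n(k)$ and arrays $R^{ab}_{cd}$, $S^{ab}_{cd}$ in $k$ with indices in $\{1,\dots,n\}$ ($a,b$ upper left and right, $c,d$ lower left and right), the *matrix model* assigns: $M_{ab}$ to a clockwise cap and $M^{-1}_{ba}$ to a counter-clockwise cap with left end $a$ and right end $b$; $M_{ba}$ to a clockwise cup and $M^{-1}_{ab}$ to a counter-clockwise cup; to an upward crossing $R^{ab}_{cd}$ if its over-strand runs from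 the lower left to the upper right and $S^{ab}_{cd}$ otherwise; to the downward crossings obtained by a half turn $R^{dc}_{ba}$, resp. $S^{dc}_{ba}$; to a left- or right-pointing crossing the contraction of a cap, a vertical crossing and a cup that is dictated by the switchback move (left-pointing, for $X=R$ if positive and $X=S$ if negative: $\sum_{i,j}M^{-1}_{ic}X^{ia}_{dj}M_{bj}$; right-pointing: $\sum_{i,j}M_{ci}X^{jd}_{ai}M^{-1}_{jb}$). A colouring assigns an index to each arc from critical point to critical point, and $Z(K)$ is the sum over all colourings of the product of the entries at all critical points of $K$. **Theorem.** Let $(A,\rho,T)$ be a balanced oriented quantum algebra over $k$, $Rep:A\to M_n(k)$ a homomorphism of $k$-algebras, and $M\in M_n(k)$ an invertible matrix such that $\tau(x)=MxM^{-1}$ satisfies $Rep(T(a))=\tau(Rep(a))$ for all $a\in A$. Write $(e\otimes e')^{ab}_{cd}=e_{ca}e'_{db}$ for the entries of an element of $M_n(k)\otimes M_n(k)$ (extended linearly), and put $R^{ab}_{cd}=Rep(\rho)^{ba}_{cd}$, $S^{ab}_{cd}=Rep(\rho^{-1})^{ab}_{dc}$, where $Rep$ is applied to both tensor factors. Then: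 1. $\tau$ restricts to $Rep(A)$ and makes $Rep(A)$, with the image of $\rho$ in $Rep(A)\otimes Rep(A)$, a balanced oriented quantum algebra. 2. The matrix model $Z$ with data $M,R,S$ is an invariant of regular isotopy of oriented links: $Z(K)=Z(K')$ for regularly isotopic oriented link diagrams $K,K'$. 3. Let $K$ be a diagram with exactly one component, choose any arc of $K$, and write $\rho=\sum_i e_i\otimes e'_i$, $\rho^{-1}=\sum_i E_i\otimes E'_i$ as finite sums (over one common index set). Decorate each positive crossing with a bead $e$ on its over-strand and $e'$ on its under-strand, each negative crossing with $E$ on its over-strand and $E'$ on its under-strand, where $T$ is moreover applied to the bead on the strand from lower left to upper right if the crossing points to the left or to the right. Slide all beads to the beginning of the strand that starts on the chosen arc and follows the orientation once around $K$, where a bead slid back through a clockwise (counter-clockwise) cap or cup is changed by $T$ (by $T^{-1}$) and beads are multiplied in their order along the strand; let $w\in A$ be the sum of the results over all choices of summands at the crossings. Then the number of clockwise minus the number of counter-clockwise caps and cups of $K$ is even, say $2d$ (so $d$ is the clockwise Whitney degree of $K$), and $$Z(K)=\operatorname{trace}\big((M^2)^{d}\,Rep(w)\big).$$ -/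

import Mathlib

open scoped TensorProduct

universe u v

namespace OQA

noncomputable section

/-! ### Oriented quantum algebras -/

section Algebra

variable (k : Type u) [CommRing k] (A : Type v) [Ring A] [Algebra k A]

/-- `a ⊗ b ↦ a ⊗ b ⊗ 1`. -/
def leg12 : A ⊗[k] A →ₐ[k] A ⊗[k] (A ⊗[k] A) :=
  Algebra.TensorProduct.map (AlgHom.id k A) Algebra.TensorProduct.includeLeft

/-- `a ⊗ b ↦ a ⊗ 1 ⊗ b`. -/
def leg13 : A ⊗[k] A →ₐ[k] A ⊗[k] (A ⊗[k] A) :=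
  Algebra.TensorProduct.map (AlgHom.id k A) Algebra.TensorProduct.includeRight

/-- `a ⊗ b ↦ 1 ⊗ a ⊗ b`. -/
def leg23 : A ⊗[k] A →ₐ[k] A ⊗[k] (A ⊗[k] A) :=
  Algebra.TensorProduct.includeRight

/-- The identification of the module `A ⊗ A` with the module `A ⊗ Aᵒᵖ`, `a ⊗ b ↦ a ⊗ b`. -/
def toOp : A ⊗[k] A →ₗ[k] A ⊗[k] Aᵐᵒᵖ :=
  TensorProduct.map LinearMap.id (MulOpposite.opLinearEquiv k).toLinearMap

/-- An oriented quantum algebra structure `(ρ, D, U)` on the `k`-algebra `A`. -/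
structure OrientedQuantumAlgebra where
  ρ : (A ⊗[k] A)ˣ
  D : A ≃ₐ[k] A
  U : A ≃ₐ[k] A
  yang_baxter :
    leg12 k A ρ * leg13 k A ρ * leg23 k A ρ = leg23 k A ρ * leg13 k A ρ * leg12 k A ρ
  commute : ∀ a, D (U a) = U (D a)
  map_U : Algebra.TensorProduct.map (U : A →ₐ[k] A) (U : A →ₐ[k] A) (ρ : A ⊗[k] A) = ρ
  map_D : Algebra.TensorProduct.map (D : A →ₐ[k] A) (D : A →ₐ[k] A) (ρ : A ⊗[k] A) = ρ
  op_inverse :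
    toOp k A (Algebra.TensorProduct.map (AlgHom.id k A) (U : A →ₐ[k] A) (ρ : A ⊗[k] A)) *
      toOp k A (Algebra.TensorProduct.map (D : A →ₐ[k] A) (AlgHom.id k A)
        ((ρ⁻¹ : (A ⊗[k] A)ˣ) : A ⊗[k] A)) = 1
  op_inverse' :
    toOp k A (Algebra.TensorProduct.map (D : A →ₐ[k] A) (AlgHom.id k A)
        ((ρ⁻¹ : (A ⊗[k] A)ˣ) : A ⊗[k] A)) *
      toOp k A (Algebra.TensorProduct.map (AlgHom.id k A) (U : A →ₐ[k] A) (ρ : A ⊗[k] A)) = 1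

variable {k A}

/-- Balanced: `U = D`; the common automorphism is the `T` of a balanced algebra. -/
def OrientedQuantumAlgebra.Balanced (Q : OrientedQuantumAlgebra k A) : Prop := Q.U = Q.D

end Algebra

/-! ### Oriented Morse link diagrams and regular isotopy -/

/-- The elementary oriented tangles. A strand crossing a horizontal level has the sign `true` if it
is oriented upwards there and `false` if it is oriented downwards.
* `cup s` is a minimum, `[] → [s, !s]`;
* `cap s` is a maximum, `[s, !s] → []`;
* `cross o s t` is a crossing, `[s, t] → [t, s]`: the strand `/` joins the bottom left to the top
  right and has sign `s`, the strand `\` joins the bottom right to the top left and has sign `t`,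
  and `/` is the over-crossing strand iff `o = true`. -/
inductive Piece where
  | cup (s : Bool)
  | cap (s : Bool)
  | cross (o s t : Bool)

def Piece.dom : Piece → List Bool
  | .cup _ => []
  | .cap s => [s, !s]
  | .cross _ s t => [s, t]

def Piece.cod : Piece → List Bool
  | .cup s => [s, !s]
  | .cap _ => []
  | .cross _ s t => [t, s]

/-- The critical points of a Morse diagram, listed from bottom to top. The entry `(p, x)` is the
elementary tangle `x` with exactly `p` vertical strands to its left. -/
abbrev Word := List (ℕ × Piece)

/-- `IsTangle a w b`: the word `w` is an oriented Morse tangle diagram with the ordered list `a` of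
signs of input strands (bottom) and the list `b` of signs of output strands (top). -/
inductive IsTangle : List Bool → Word → List Bool → Prop
  | nil (a : List Bool) : IsTangle a [] a
  | cons (l r : List Bool) (x : Piece) (w : Word) (b : List Bool)
      (h : IsTangle (l ++ x.cod ++ r) w b) : IsTangle (l ++ x.dom ++ r) ((l.length, x) :: w) b

/-- Oriented link diagrams, as Morse diagrams with no inputs and no outputs. -/
structure LinkDiagram where
  word : Word
  closed : IsTangle [] word []

/-- Place `p` further vertical strands to the left. -/
def shift (p : ℕ) (w : Word) : Word := w.map fun x => (x.1 + p, x.2)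

/-- The local moves, for all orientations and all choices of crossings. -/
inductive Move : Word → Word → Prop
  /-- Critical points that are horizontally apart exchange their heights. -/
  | interchange (x y : Piece) (m : ℕ) :
      Move [(0, x), (x.cod.length + m, y)] [(x.dom.length + m, y), (0, x)]
  /-- Planar isotopy: cancellation of a maximum with a minimum. -/
  | zigzag_left (s : Bool) : Move [(0, .cup s), (1, .cap !s)] []
  | zigzag_right (s : Bool) : Move [(1, .cup !s), (0, .cap s)] []
  /-- Reidemeister move 2, for parallel strands `s = t` and for reversed strands `s ≠ t`. -/
  | two (o s t : Bool) : Move [(0, .cross o s t), (0, .cross (!o) t s)] []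
  /-- Reidemeister move 3. The pairs of strands 12, 13, 23 have the crossing types `a`, `b`, `c`; the two cyclic
  choices, for which the three strands do not lie one above another, are excluded. -/
  | three (a b c s t r : Bool) (h : ¬ (a = c ∧ b ≠ a)) :
      Move [(0, .cross a s t), (1, .cross b s r), (0, .cross c t r)]
        [(1, .cross c t r), (0, .cross b s r), (1, .cross a s t)]
  /-- Switchback move: a strand of sign `r` passes over or under a maximum or a minimum. -/
  | four_cap (o s r : Bool) :
      Move [(0, .cross o s r), (1, .cap s)] [(1, .cross (!o) r !s), (0, .cap s)]
  | four_cup (o s r : Bool) :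
      Move [(1, .cup s), (0, .cross o r s)] [(0, .cup s), (1, .cross (!o) (!s) r)]

/-- One application of a move inside a link diagram. -/
def LinkDiagram.Step (K K' : LinkDiagram) : Prop :=
  ∃ (u v : Word) (p : ℕ) (L L' : Word), Move L L' ∧
    K.word = u ++ shift p L ++ v ∧ K'.word = u ++ shift p L' ++ v

/-- Regular isotopy: the equivalence relation generated by the moves (Reidemeister move 1 is not
among them). -/
def LinkDiagram.RegularIsotopic : LinkDiagram → LinkDiagram → Prop :=
  Relation.EqvGen LinkDiagram.Step

/-! ### Marked and coloured diagrams -/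

section Marking

variable {β : Type u}

/-- One element of `β` for each marked point, i.e. for each arc of the diagram that runs from
critical point to critical point. An arc is recorded at its lower end: cups and crossings have two
arcs leaving at their top (left one first), caps have none. -/
def Marking (β : Type u) : Word → Type u
  | [] => PUnit
  | (_, .cup _) :: w => β × β × Marking β w
  | (_, .cap _) :: w => Marking β w
  | (_, .cross _ _ _) :: w => β × β × Marking β w

instance markingFintype (β : Type u) [Fintype β] : (w : Word) → Fintype (Marking β w)
  | [] => inferInstanceAs (Fintype PUnit)
  | (_, .cup _) :: w =>
    letI := markingFintype β w
    inferInstanceAs (Fintype (β × β × Marking β w))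
  | (_, .cap _) :: w => markingFintype β w
  | (_, .cross _ _ _) :: w =>
    letI := markingFintype β w
    inferInstanceAs (Fintype (β × β × Marking β w))

/-- A critical point together with the marks of its arcs: left and right for cups and caps; top
left, top right, bottom left, bottom right for crossings. -/
inductive CriticalPoint (β : Type u) where
  | cup (s : Bool) (a b : β)
  | cap (s : Bool) (a b : β)
  | cross (o s t : Bool) (a b c d : β)

/-- The marked critical points of a diagram, from bottom to top; `cur` holds the marks of the
strands that enter from below. (The cases `_ => []` do not occur in a tangle diagram.) -/
def critical : (w : Word) → (cur : List β) → Marking β w → List (CriticalPoint β)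
  | [], _, _ => []
  | (p, .cup s) :: w, cur, (a, b, χ) =>
    .cup s a b :: critical w (cur.take p ++ a :: b :: cur.drop p) χ
  | (p, .cap s) :: w, cur, χ =>
    match cur.drop p with
    | a :: b :: r => .cap s a b :: critical w (cur.take p ++ r) χ
    | _ => []
  | (p, .cross o s t) :: w, cur, (a, b, χ) =>
    match cur.drop p with
    | c :: d :: r => .cross o s t a b c d :: critical w (cur.take p ++ a :: b :: r) χ
    | _ => []

end Marking

/-! ### Matrix models -/

/-- Background matrices `M`, `R`, `S` of size `n`; `R a b c d` is the entry of `R` with upper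
indices `a b` and lower indices `c d`, and likewise for `S`. -/
structure MatrixModel (n : ℕ) (k : Type u) [CommRing k] where
  M : (Matrix (Fin n) (Fin n) k)ˣ
  R : Fin n → Fin n → Fin n → Fin n → k
  S : Fin n → Fin n → Fin n → Fin n → k

namespace MatrixModel

variable {n : ℕ} {k : Type u} [CommRing k] (X : MatrixModel n k)

/-- Maxima: clockwise (left end upwards) `M a b`, counter-clockwise `M⁻¹ b a`. -/
def cap : Bool → Fin n → Fin n → k
  | true, a, b => X.M.val a b
  | false, a, b => X.M⁻¹.val b a

/-- Minima: clockwise (left end upwards) `M b a`, counter-clockwise `M⁻¹ a b`. -/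
def cup : Bool → Fin n → Fin n → k
  | true, a, b => X.M.val b a
  | false, a, b => X.M⁻¹.val a b

/-- The eight crossing matrices. In this order: both strands upwards, both strands
downwards, both strands to the left, both strands to the right. -/
def cross : (o s t : Bool) → (a b c d : Fin n) → k
  | true, true, true, a, b, c, d => X.R a b c d
  | false, true, true, a, b, c, d => X.S a b c d
  | true, false, false, a, b, c, d => X.R d c b a
  | false, false, false, a, b, c, d => X.S d c b a
  | false, false, true, a, b, c, d =>
    ∑ i, ∑ j, X.cap false c i * X.R i a d j * X.cup true j b
  | true, false, true, a, b, c, d =>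
    ∑ i, ∑ j, X.cap false c i * X.S i a d j * X.cup true j b
  | false, true, false, a, b, c, d =>
    ∑ i, ∑ j, X.cap true c i * X.R j d a i * X.cup false j b
  | true, true, false, a, b, c, d =>
    ∑ i, ∑ j, X.cap true c i * X.S j d a i * X.cup false j b

/-- The matrix entry of a coloured critical point. -/
def weight : CriticalPoint (Fin n) → k
  | .cup s a b => X.cup s a b
  | .cap s a b => X.cap s a b
  | .cross o s t a b c d => X.cross o s t a b c d

/-- The evaluation `Z(K)`: the sum over all colourings of the marked points by indices of the
product of the matrix entries at all critical points. -/
def Z (K : LinkDiagram) : k :=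
  ∑ χ : Marking (Fin n) K.word, ((critical K.word [] χ).map X.weight).prod

end MatrixModel

section Rep

variable {n : ℕ} {k : Type u} [CommRing k] {A : Type v} [Ring A] [Algebra k A]

/-- The entry of `x ∈ M_n(k) ⊗ M_n(k)` with upper indices `a b` and lower indices `c d`; for
`x = e ⊗ e'` it is `e c a * e' d b`, as lower indices are row indices. -/
def tensorEntry (x : Matrix (Fin n) (Fin n) k ⊗[k] Matrix (Fin n) (Fin n) k)
    (a b c d : Fin n) : k :=
  LinearMap.mul' k k
    (TensorProduct.map (Matrix.entryLinearMap k k c a) (Matrix.entryLinearMap k k d b) x)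

/-- The matrix model with background matrices given by `Rep(ρ)`, `Rep(ρ⁻¹)` and `M`: the upper
indices of `Rep(ρ)` and the lower indices of `Rep(ρ⁻¹)` are permuted. -/
def matrixModel (Q : OrientedQuantumAlgebra k A) (Rep : A →ₐ[k] Matrix (Fin n) (Fin n) k)
    (M : (Matrix (Fin n) (Fin n) k)ˣ) : MatrixModel n k where
  M := M
  R a b c d := tensorEntry (Algebra.TensorProduct.map Rep Rep (Q.ρ : A ⊗[k] A)) b a c d
  S a b c d := tensorEntry (Algebra.TensorProduct.map Rep Rep
    ((Q.ρ⁻¹ : (A ⊗[k] A)ˣ) : A ⊗[k] A)) a b d c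

end Rep

/-! ### Beads on a closed loop -/

/-- The marking of the arcs of a diagram by `m, m + 1, m + 2, …`. -/
def numbering : (w : Word) → ℕ → Marking ℕ w
  | [], _ => PUnit.unit
  | (_, .cup _) :: w, m => (m, m + 1, numbering w (m + 2))
  | (_, .cap _) :: w, m => numbering w m
  | (_, .cross _ _ _) :: w, m => (m, m + 1, numbering w (m + 2))

/-- The critical points of `K` with numbered arcs. -/
def LinkDiagram.points (K : LinkDiagram) : List (CriticalPoint ℕ) :=
  critical K.word [] (numbering K.word 0)

/-- The pairs (incoming arc, outgoing arc), with respect to the orientation, of the strands through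
a critical point; at a crossing `/` comes first and `\` second. -/
def CriticalPoint.flow : CriticalPoint ℕ → List (ℕ × ℕ)
  | .cup s a b => [if s then (b, a) else (a, b)]
  | .cap s a b => [if s then (a, b) else (b, a)]
  | .cross _ s t a b c d => [if s then (c, b) else (b, c), if t then (d, a) else (a, d)]

/-- All strands through critical points of `K`; every arc is the incoming arc of one of them. -/
def LinkDiagram.flow (K : LinkDiagram) : List (ℕ × ℕ) := K.points.flatMap CriticalPoint.flow

/-- `K` is a closed loop (a diagram with exactly one component): it is not empty, and following the
orientation one gets from every arc to every other one. -/
def LinkDiagram.IsLoop (K : LinkDiagram) : Prop :=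
  K.flow ≠ [] ∧ ∀ x ∈ K.flow, ∀ y ∈ K.flow,
    Relation.ReflTransGen (fun a b => (a, b) ∈ K.flow) x.1 y.1

/-- The half turns of an elementary piece: `1` for a clockwise maximum or minimum, `-1` for a
counter-clockwise one. -/
def Piece.halfTurns : Piece → ℤ
  | .cup s => if s then 1 else -1
  | .cap s => if s then 1 else -1
  | .cross _ _ _ => 0

/-- Twice the (clockwise) Whitney degree of the underlying flat diagram. -/
def LinkDiagram.halfTurns (K : LinkDiagram) : ℤ := (K.word.map fun x => x.2.halfTurns).sum

/-- What one meets along a strand of a decorated flat diagram: a maximum or minimum, which turns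
clockwise (`true`) or counter-clockwise (`false`), or a bead labelled by an algebra element. -/
inductive Letter (A : Type v) where
  | turn (cw : Bool)
  | bead (a : A)

section Beads

variable {k : Type u} [CommRing k] {A : Type v} [Ring A] [Algebra k A] {I : Type}

/-- A choice of a summand `i : I` of `ρ = ∑ i, e i ⊗ e' i`, resp. `ρ⁻¹ = ∑ i, E i ⊗ E' i`, at each
crossing. -/
def Labels (I : Type) : List (CriticalPoint ℕ) → Type
  | [] => Unit
  | .cup _ _ _ :: L => Labels I L
  | .cap _ _ _ :: L => Labels I L
  | .cross _ _ _ _ _ _ _ :: L => I × Labels I L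

instance labelsFintype (I : Type) [Fintype I] : (L : List (CriticalPoint ℕ)) → Fintype (Labels I L)
  | [] => inferInstanceAs (Fintype Unit)
  | .cup _ _ _ :: L => labelsFintype I L
  | .cap _ _ _ :: L => labelsFintype I L
  | .cross _ _ _ _ _ _ _ :: L =>
    letI := labelsFintype I L
    inferInstanceAs (Fintype (I × Labels I L))

/-- The two beads at a crossing, on `/` and on `\`, when `ρ = e ⊗ e'` and `ρ⁻¹ = E ⊗ E'`. The
crossing is positive iff `o = (s == t)`. A positive crossing has `e` on its over-strand and `e'` on
its under-strand, a negative one `E` on its over-strand and `E'` on its under-strand; at the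
horizontal crossings (`s ≠ t`) `T` is applied to the bead on `/`. -/
def crossingBeads (T : A ≃ₐ[k] A) (e e' E E' : A) (o s t : Bool) : A × A :=
  let top := if o == (s == t) then e else E
  let bottom := if o == (s == t) then e' else E'
  let slash := if o then top else bottom
  let backslash := if o then bottom else top
  (if s == t then slash else T slash, backslash)

/-- The strands through the critical points, each with its letter: the decoration of the flat
diagram for a given choice of summands. The pairs are those of `CriticalPoint.flow`. -/
def decorate (T : A ≃ₐ[k] A) (e e' E E' : I → A) :
    (L : List (CriticalPoint ℕ)) → Labels I L → List ((ℕ × ℕ) × Letter A)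
  | [], _ => []
  | .cup s a b :: L, f =>
    (CriticalPoint.cup s a b).flow.zip [.turn s] ++ decorate T e e' E E' L f
  | .cap s a b :: L, f =>
    (CriticalPoint.cap s a b).flow.zip [.turn s] ++ decorate T e e' E E' L f
  | .cross o s t a b c d :: L, (i, f) =>
    let x := crossingBeads T (e i) (e' i) (E i) (E' i) o s t
    (CriticalPoint.cross o s t a b c d).flow.zip [.bead x.1, .bead x.2] ++
      decorate T e e' E E' L f

/-- The letters met on the first `m` strands when one starts on the arc `a` and follows the
orientation. -/
def walk (P : List ((ℕ × ℕ) × Letter A)) : (m a : ℕ) → List (Letter A)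
  | 0, _ => []
  | m + 1, a =>
    match P.find? fun x => x.1.1 == a with
    | some x => x.2 :: walk P m x.1.2
    | none => []

/-- Slide all beads to the beginning of the strand: sliding back through a clockwise turn applies
`T`, through a counter-clockwise turn `T⁻¹`. Beads multiply in their order along the strand. -/
def slide (T : A ≃ₐ[k] A) : List (Letter A) → A
  | [] => 1
  | .bead a :: L => a * slide T L
  | .turn true :: L => T (slide T L)
  | .turn false :: L => T.symm (slide T L)

/-- The algebra element `w` that results when, for a closed loop `K`, all beads are slid to the arc
`a`, summed over all choices of summands of `ρ` and `ρ⁻¹`. -/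
def LinkDiagram.beadWord [Fintype I] (K : LinkDiagram) (T : A ≃ₐ[k] A) (e e' E E' : I → A)
    (a : ℕ) : A :=
  ∑ f : Labels I K.points,
    slide T (walk (decorate T e e' E E' K.points f) K.flow.length a)

end Beads

end

end OQA

namespace OQA

/-! ### Matrices on two and three tensor factors -/

section Legs

open Matrix
open scoped Kronecker

variable {ι : Type*} {k : Type u}

/-- Exchange of the two tensor factors. -/
def swapFactors (X : Matrix (ι × ι) (ι × ι) k) : Matrix (ι × ι) (ι × ι) k :=
  X.submatrix Prod.swap Prod.swap

/-- Transposition in the first tensor factor. -/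
def transposeFst (X : Matrix (ι × ι) (ι × ι) k) : Matrix (ι × ι) (ι × ι) k :=
  fun p q => X (q.1, p.2) (p.1, q.2)

/-- Transposition in the second tensor factor. -/
def transposeSnd (X : Matrix (ι × ι) (ι × ι) k) : Matrix (ι × ι) (ι × ι) k :=
  fun p q => X (p.1, q.2) (q.1, p.2)

/-- Transposition in the last of three tensor factors. -/
def transposeThird (X : Matrix (ι × ι × ι) (ι × ι × ι) k) : Matrix (ι × ι × ι) (ι × ι × ι) k :=
  fun p q => X (p.1, p.2.1, q.2.2) (q.1, q.2.1, p.2.2)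

@[simp] lemma swapFactors_swapFactors (X : Matrix (ι × ι) (ι × ι) k) :
    swapFactors (swapFactors X) = X := rfl

@[simp] lemma transposeFst_transposeFst (X : Matrix (ι × ι) (ι × ι) k) :
    transposeFst (transposeFst X) = X := rfl

@[simp] lemma transposeSnd_transposeSnd (X : Matrix (ι × ι) (ι × ι) k) :
    transposeSnd (transposeSnd X) = X := rfl

lemma swapFactors_transposeFst (X : Matrix (ι × ι) (ι × ι) k) :
    swapFactors (transposeFst X) = transposeSnd (swapFactors X) := rfl

lemma swapFactors_transposeSnd (X : Matrix (ι × ι) (ι × ι) k) :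
    swapFactors (transposeSnd X) = transposeFst (swapFactors X) := rfl

lemma swapFactors_transpose (X : Matrix (ι × ι) (ι × ι) k) :
    swapFactors Xᵀ = (swapFactors X)ᵀ := rfl

lemma transposeFst_eq (X : Matrix (ι × ι) (ι × ι) k) :
    transposeFst X = (transposeSnd X)ᵀ := rfl

variable [CommRing k]

lemma swapFactors_kronecker (m m' : Matrix ι ι k) : swapFactors (m ⊗ₖ m') = m' ⊗ₖ m := by
  ext ⟨i, j⟩ ⟨i', j'⟩
  simp [swapFactors, mul_comm]

lemma swapFactors_mul [Fintype ι] (X Y : Matrix (ι × ι) (ι × ι) k) :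
    swapFactors (X * Y) = swapFactors X * swapFactors Y :=
  (submatrix_mul_equiv X Y Prod.swap (Equiv.prodComm ι ι) Prod.swap).symm

/-- The transposition of the first two of three indices. -/
def swap12 : ι × ι × ι ≃ ι × ι × ι where
  toFun p := (p.2.1, p.1, p.2.2)
  invFun p := (p.2.1, p.1, p.2.2)
  left_inv _ := rfl
  right_inv _ := rfl

/-- The transposition of the last two of three indices. -/
def swap23 : ι × ι × ι ≃ ι × ι × ι where
  toFun p := (p.1, p.2.2, p.2.1)
  invFun p := (p.1, p.2.2, p.2.1)
  left_inv _ := rfl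
  right_inv _ := rfl

/-- The transposition of the outer two of three indices. -/
def swap13 : ι × ι × ι ≃ ι × ι × ι where
  toFun p := (p.2.2, p.2.1, p.1)
  invFun p := (p.2.2, p.2.1, p.1)
  left_inv _ := rfl
  right_inv _ := rfl

/-- The cyclic permutation of three indices. -/
def rotateIndices : ι × ι × ι ≃ ι × ι × ι where
  toFun p := (p.2.1, p.2.2, p.1)
  invFun p := (p.2.2, p.1, p.2.1)
  left_inv _ := rfl
  right_inv _ := rfl

variable [DecidableEq ι]

lemma swapFactors_one : swapFactors (1 : Matrix (ι × ι) (ι × ι) k) = 1 :=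
  submatrix_one_equiv (Equiv.prodComm ι ι)


/-- `X` on the factors 1 and 2. -/
def onLeg12 (X : Matrix (ι × ι) (ι × ι) k) : Matrix (ι × ι × ι) (ι × ι × ι) k :=
  fun p q => X (p.1, p.2.1) (q.1, q.2.1) * (1 : Matrix ι ι k) p.2.2 q.2.2

/-- `X` on the factors 1 and 3. -/
def onLeg13 (X : Matrix (ι × ι) (ι × ι) k) : Matrix (ι × ι × ι) (ι × ι × ι) k :=
  fun p q => X (p.1, p.2.2) (q.1, q.2.2) * (1 : Matrix ι ι k) p.2.1 q.2.1

/-- `X` on the factors 2 and 3. -/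
def onLeg23 (X : Matrix (ι × ι) (ι × ι) k) : Matrix (ι × ι × ι) (ι × ι × ι) k :=
  fun p q => X (p.2.1, p.2.2) (q.2.1, q.2.2) * (1 : Matrix ι ι k) p.1 q.1

/-- `m` on the factor 3. -/
def onLeg3 (m : Matrix ι ι k) : Matrix (ι × ι × ι) (ι × ι × ι) k := onLeg23 (1 ⊗ₖ m)

lemma onLeg3_eq_onLeg13 (m : Matrix ι ι k) : onLeg3 m = onLeg13 (1 ⊗ₖ m) := by
  ext ⟨i, j, l⟩ ⟨i', j', l'⟩
  simp only [onLeg3, onLeg23, onLeg13, kroneckerMap_apply]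
  ring

@[simp] lemma onLeg12_one : onLeg12 (1 : Matrix (ι × ι) (ι × ι) k) = 1 := by
  ext ⟨i, j, l⟩ ⟨i', j', l'⟩
  by_cases h : i = i' <;> by_cases h' : j = j' <;> simp [onLeg12, one_apply, h, h']

@[simp] lemma onLeg13_one : onLeg13 (1 : Matrix (ι × ι) (ι × ι) k) = 1 := by
  ext ⟨i, j, l⟩ ⟨i', j', l'⟩
  by_cases h : i = i' <;> by_cases h' : j = j' <;> simp [onLeg13, one_apply, h, h']

@[simp] lemma onLeg23_one : onLeg23 (1 : Matrix (ι × ι) (ι × ι) k) = 1 := by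
  ext ⟨i, j, l⟩ ⟨i', j', l'⟩
  by_cases h : i = i' <;> by_cases h' : j = j' <;> simp [onLeg23, one_apply, h, h']

lemma transpose_onLeg12 (X : Matrix (ι × ι) (ι × ι) k) : (onLeg12 X)ᵀ = onLeg12 Xᵀ := by
  ext ⟨i, j, l⟩ ⟨i', j', l'⟩
  simp [onLeg12, one_apply, eq_comm]

lemma transpose_onLeg13 (X : Matrix (ι × ι) (ι × ι) k) : (onLeg13 X)ᵀ = onLeg13 Xᵀ := by
  ext ⟨i, j, l⟩ ⟨i', j', l'⟩
  simp [onLeg13, one_apply, eq_comm]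

lemma transpose_onLeg23 (X : Matrix (ι × ι) (ι × ι) k) : (onLeg23 X)ᵀ = onLeg23 Xᵀ := by
  ext ⟨i, j, l⟩ ⟨i', j', l'⟩
  simp [onLeg23, one_apply, eq_comm]

lemma onLeg13_eq_submatrix (X : Matrix (ι × ι) (ι × ι) k) :
    onLeg13 X = (onLeg12 X).submatrix swap23 swap23 := rfl

lemma onLeg23_eq_submatrix (X : Matrix (ι × ι) (ι × ι) k) :
    onLeg23 X = (onLeg12 X).submatrix rotateIndices rotateIndices := rfl

variable [Fintype ι]

lemma transposeFst_conj (m m' : Matrix ι ι k) (X : Matrix (ι × ι) (ι × ι) k) :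
    transposeFst ((m ⊗ₖ 1) * X * (m' ⊗ₖ 1)) = (m'ᵀ ⊗ₖ 1) * transposeFst X * (mᵀ ⊗ₖ 1) := by
  ext ⟨i, j⟩ ⟨i', j'⟩
  simp only [transposeFst, mul_apply, Fintype.sum_prod_type, kroneckerMap_apply, one_apply,
    mul_ite, mul_one, mul_zero, ite_mul, zero_mul, Finset.sum_ite_eq, Finset.sum_ite_eq',
    Finset.mem_univ, if_true, transpose_apply, Finset.sum_mul]
  rw [Finset.sum_comm]
  exact Finset.sum_congr rfl fun _ _ => Finset.sum_congr rfl fun _ _ => by ring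

lemma transposeSnd_conj (m m' : Matrix ι ι k) (X : Matrix (ι × ι) (ι × ι) k) :
    transposeSnd ((m ⊗ₖ 1) * X * (m' ⊗ₖ 1)) = (m ⊗ₖ 1) * transposeSnd X * (m' ⊗ₖ 1) := by
  ext ⟨i, j⟩ ⟨i', j'⟩
  simp only [transposeSnd, mul_apply, Fintype.sum_prod_type, kroneckerMap_apply, one_apply,
    mul_ite, mul_one, mul_zero, ite_mul, zero_mul, Finset.sum_ite_eq, Finset.sum_ite_eq',
    Finset.mem_univ, if_true]

lemma onLeg12_mul (X Y : Matrix (ι × ι) (ι × ι) k) :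
    onLeg12 (X * Y) = onLeg12 X * onLeg12 Y := by
  ext ⟨i, j, l⟩ ⟨i', j', l'⟩
  by_cases h : l = l' <;> simp [onLeg12, mul_apply, Fintype.sum_prod_type, one_apply, h]

lemma onLeg23_mul (X Y : Matrix (ι × ι) (ι × ι) k) :
    onLeg23 (X * Y) = onLeg23 X * onLeg23 Y := by
  simp only [onLeg23_eq_submatrix, onLeg12_mul, submatrix_mul_equiv]

lemma onLeg13_mul (X Y : Matrix (ι × ι) (ι × ι) k) :
    onLeg13 (X * Y) = onLeg13 X * onLeg13 Y := by
  simp only [onLeg13_eq_submatrix, onLeg12_mul, submatrix_mul_equiv]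

lemma transposeThird_onLeg12_mul (X : Matrix (ι × ι) (ι × ι) k)
    (Z : Matrix (ι × ι × ι) (ι × ι × ι) k) :
    transposeThird (onLeg12 X * Z) = onLeg12 X * transposeThird Z := by
  ext ⟨i, j, l⟩ ⟨i', j', l'⟩
  simp only [transposeThird, onLeg12, mul_apply, Fintype.sum_prod_type, one_apply,
    mul_ite, mul_one, mul_zero, ite_mul, zero_mul, Finset.sum_ite_eq, Finset.mem_univ, if_true]

lemma transposeThird_mul_onLeg12 (X : Matrix (ι × ι) (ι × ι) k)
    (Z : Matrix (ι × ι × ι) (ι × ι × ι) k) :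
    transposeThird (Z * onLeg12 X) = transposeThird Z * onLeg12 X := by
  ext ⟨i, j, l⟩ ⟨i', j', l'⟩
  simp only [transposeThird, onLeg12, mul_apply, Fintype.sum_prod_type, one_apply,
    mul_ite, mul_one, mul_zero, Finset.sum_ite_eq', Finset.mem_univ, if_true]

lemma onLeg13_mul_onLeg23_apply (X Y : Matrix (ι × ι) (ι × ι) k) (i j l i' j' l' : ι) :
    (onLeg13 X * onLeg23 Y) (i, j, l) (i', j', l') =
      ∑ m, X (i, l) (i', m) * Y (j, m) (j', l') := by
  simp only [onLeg13, onLeg23, mul_apply, Fintype.sum_prod_type, one_apply,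
    mul_ite, mul_one, mul_zero, ite_mul, zero_mul]
  rw [Finset.sum_eq_single i' (by
    intro b _ hb
    simp [hb]) (by simp)]
  rw [Finset.sum_eq_single j (by
    intro b _ hb
    simp [hb.symm]) (by simp)]
  simp

lemma onLeg23_mul_onLeg13_apply (X Y : Matrix (ι × ι) (ι × ι) k) (i j l i' j' l' : ι) :
    (onLeg23 X * onLeg13 Y) (i, j, l) (i', j', l') =
      ∑ m, X (j, l) (j', m) * Y (i, m) (i', l') := by
  simp only [onLeg13, onLeg23, mul_apply, Fintype.sum_prod_type, one_apply,
    mul_ite, mul_one, mul_zero, ite_mul, zero_mul]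
  rw [Finset.sum_eq_single i (by
    intro b _ hb
    simp [hb.symm]) (by simp)]
  rw [Finset.sum_eq_single j' (by
    intro b _ hb
    simp [hb]) (by simp)]
  simp

lemma transposeThird_onLeg13_mul_onLeg23 (X Y : Matrix (ι × ι) (ι × ι) k) :
    transposeThird (onLeg13 X * onLeg23 Y) =
      onLeg23 (transposeSnd Y) * onLeg13 (transposeSnd X) := by
  ext ⟨i, j, l⟩ ⟨i', j', l'⟩
  rw [transposeThird, onLeg13_mul_onLeg23_apply, onLeg23_mul_onLeg13_apply]
  exact Finset.sum_congr rfl fun _ _ => mul_comm _ _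

lemma transposeThird_onLeg23_mul_onLeg13 (X Y : Matrix (ι × ι) (ι × ι) k) :
    transposeThird (onLeg23 X * onLeg13 Y) =
      onLeg13 (transposeSnd Y) * onLeg23 (transposeSnd X) := by
  ext ⟨i, j, l⟩ ⟨i', j', l'⟩
  rw [transposeThird, onLeg13_mul_onLeg23_apply, onLeg23_mul_onLeg13_apply]
  exact Finset.sum_congr rfl fun _ _ => mul_comm _ _

lemma onLeg12_mul_onLeg3 (X : Matrix (ι × ι) (ι × ι) k) (m : Matrix ι ι k) :
    onLeg12 X * onLeg3 m = onLeg3 m * onLeg12 X := by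
  have h : onLeg3 m = fun p q => (1 : Matrix (ι × ι) (ι × ι) k) (p.1, p.2.1) (q.1, q.2.1) *
      m p.2.2 q.2.2 := by
    ext ⟨i, j, l⟩ ⟨i', j', l'⟩
    by_cases h : i = i' <;> by_cases h' : j = j' <;> simp [onLeg3, onLeg23, one_apply, h, h']
  ext ⟨i, j, l⟩ ⟨i', j', l'⟩
  rw [mul_apply, mul_apply, Finset.sum_eq_single (i', j', l), Finset.sum_eq_single (i, j, l')]
  · simp [h, onLeg12, mul_comm]
  · rintro ⟨a, b, c⟩ - hne
    by_cases h1 : i = a <;> by_cases h2 : j = b <;> by_cases h3 : c = l' <;>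
      simp_all [onLeg12, one_apply]
  · simp
  · rintro ⟨a, b, c⟩ - hne
    by_cases h1 : a = i' <;> by_cases h2 : b = j' <;> by_cases h3 : l = c <;>
      simp_all [onLeg12, one_apply]
  · simp

lemma onLeg12_mulVec (X : Matrix (ι × ι) (ι × ι) k) (f : ι × ι × ι → k) (i j l : ι) :
    (onLeg12 X *ᵥ f) (i, j, l) = ∑ a, ∑ b, X (i, j) (b, a) * f (b, a, l) := by
  rw [Finset.sum_comm]
  simp only [mulVec, dotProduct, onLeg12, Fintype.sum_prod_type, one_apply,
    mul_ite, mul_one, mul_zero, ite_mul, zero_mul, Finset.sum_ite_eq, Finset.mem_univ, if_true]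

lemma onLeg13_mulVec (X : Matrix (ι × ι) (ι × ι) k) (f : ι × ι × ι → k) (i j l : ι) :
    (onLeg13 X *ᵥ f) (i, j, l) = ∑ a, ∑ b, X (i, l) (b, a) * f (b, j, a) := by
  rw [Finset.sum_comm]
  simp only [mulVec, dotProduct, onLeg13, Fintype.sum_prod_type, one_apply,
    mul_ite, mul_one, mul_zero, ite_mul, zero_mul]
  refine Finset.sum_congr rfl fun b _ => ?_
  rw [Finset.sum_comm]
  simp

lemma onLeg23_mulVec (X : Matrix (ι × ι) (ι × ι) k) (f : ι × ι × ι → k) (i j l : ι) :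
    (onLeg23 X *ᵥ f) (i, j, l) = ∑ a, ∑ b, X (j, l) (b, a) * f (i, b, a) := by
  rw [Finset.sum_comm]
  simp only [mulVec, dotProduct, onLeg23, Fintype.sum_prod_type, one_apply,
    mul_ite, mul_one, mul_zero, ite_mul, zero_mul]
  rw [Finset.sum_eq_single i (by
    intro b _ hb
    simp [hb.symm]) (by simp)]
  simp

/-! ### The Yang-Baxter equation for three matrices -/

/-- The Yang-Baxter equation for three matrices. -/
def YangBaxter (X Y Z : Matrix (ι × ι) (ι × ι) k) : Prop :=
  onLeg12 X * onLeg13 Y * onLeg23 Z = onLeg23 Z * onLeg13 Y * onLeg12 X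

namespace YangBaxter

variable {X Y Z X' Y' Z' : Matrix (ι × ι) (ι × ι) k}

lemma transpose (h : YangBaxter X Y Z) : YangBaxter Xᵀ Yᵀ Zᵀ := by
  have := congrArg Matrix.transpose h
  simp only [transpose_mul, transpose_onLeg12, transpose_onLeg13, transpose_onLeg23,
    ← mul_assoc] at this
  exact this.symm

lemma swap_outer (h : YangBaxter X Y Z) :
    YangBaxter (swapFactors Z) (swapFactors Y) (swapFactors X) := by
  have := congrArg (fun W => W.submatrix swap13 swap13) h
  simp only [← submatrix_mul_equiv _ _ _ swap13 _] at this
  exact this.symm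

lemma swap_last (h : YangBaxter X Y Z) (hZ : Z * Z' = 1) : YangBaxter Y X (swapFactors Z') := by
  have := congrArg (fun W => W.submatrix swap23 swap23) h
  simp only [← submatrix_mul_equiv _ _ _ swap23 _] at this
  change onLeg13 X * onLeg12 Y * onLeg23 (swapFactors Z) =
    onLeg23 (swapFactors Z) * onLeg12 Y * onLeg13 X at this
  have h1 : onLeg23 (swapFactors Z) * onLeg23 (swapFactors Z') = 1 := by
    rw [← onLeg23_mul, ← swapFactors_mul, hZ, swapFactors_one, onLeg23_one]
  have h2 := mul_eq_one_comm.1 h1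
  calc onLeg12 Y * onLeg13 X * onLeg23 (swapFactors Z')
      = onLeg23 (swapFactors Z') * (onLeg23 (swapFactors Z) * onLeg12 Y * onLeg13 X) *
          onLeg23 (swapFactors Z') := by simp only [← mul_assoc, h2, one_mul]
    _ = onLeg23 (swapFactors Z') * onLeg13 X * onLeg12 Y := by
      rw [← this]; simp only [mul_assoc, h1, mul_one]

lemma swap_first (h : YangBaxter X Y Z) (hX : X * X' = 1) : YangBaxter (swapFactors X') Z Y := by
  have := congrArg (fun W => W.submatrix swap12 swap12) h
  simp only [← submatrix_mul_equiv _ _ _ swap12 _] at this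
  change onLeg12 (swapFactors X) * onLeg23 Y * onLeg13 Z =
    onLeg13 Z * onLeg23 Y * onLeg12 (swapFactors X) at this
  have h1 : onLeg12 (swapFactors X) * onLeg12 (swapFactors X') = 1 := by
    rw [← onLeg12_mul, ← swapFactors_mul, hX, swapFactors_one, onLeg12_one]
  have h2 := mul_eq_one_comm.1 h1
  calc onLeg12 (swapFactors X') * onLeg13 Z * onLeg23 Y
      = onLeg12 (swapFactors X') * (onLeg13 Z * onLeg23 Y * onLeg12 (swapFactors X)) *
          onLeg12 (swapFactors X') := by simp only [mul_assoc, h1, mul_one]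
    _ = onLeg23 Y * onLeg13 Z * onLeg12 (swapFactors X') := by
      rw [← this]; simp only [← mul_assoc, h2, one_mul]

lemma inverse (h : YangBaxter X Y Z) (hX : X * X' = 1) (hY : Y * Y' = 1) (hZ : Z * Z' = 1) :
    YangBaxter X' Y' Z' := by
  have h1 : onLeg12 X * onLeg12 X' = 1 := by rw [← onLeg12_mul, hX, onLeg12_one]
  have h2 : onLeg13 Y * onLeg13 Y' = 1 := by rw [← onLeg13_mul, hY, onLeg13_one]
  have h3 : onLeg23 Z * onLeg23 Z' = 1 := by rw [← onLeg23_mul, hZ, onLeg23_one]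
  have h4 : (onLeg12 X * onLeg13 Y * onLeg23 Z) *
      (onLeg23 Z' * onLeg13 Y' * onLeg12 X') = 1 := by
    simp only [mul_assoc]
    rw [← mul_assoc (onLeg23 Z), h3, one_mul, ← mul_assoc (onLeg13 Y), h2, one_mul, h1]
  have h5 : (onLeg12 X * onLeg13 Y * onLeg23 Z) *
      (onLeg12 X' * onLeg13 Y' * onLeg23 Z') = 1 := by
    rw [show _ = _ from h]
    simp only [mul_assoc]
    rw [← mul_assoc (onLeg12 X), h1, one_mul, ← mul_assoc (onLeg13 Y), h2, one_mul, h3]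
  have h6 := mul_eq_one_comm.1 h4
  calc onLeg12 X' * onLeg13 Y' * onLeg23 Z'
      = ((onLeg23 Z' * onLeg13 Y' * onLeg12 X') * (onLeg12 X * onLeg13 Y * onLeg23 Z)) *
        (onLeg12 X' * onLeg13 Y' * onLeg23 Z') := by rw [h6, one_mul]
    _ = onLeg23 Z' * onLeg13 Y' * onLeg12 X' := by rw [mul_assoc, h5, mul_one]

/-- Reversal of the third strand. -/
lemma reverse_third (h : YangBaxter X Y Z) (hX : X * X' = 1) (hY : Y * Y' = 1) (hZ : Z * Z' = 1)
    {m m' : Matrix ι ι k} (hm : m' * m = 1) :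
    YangBaxter X (transposeSnd ((1 ⊗ₖ m) * Y' * (1 ⊗ₖ m')))
      (transposeSnd ((1 ⊗ₖ m) * Z' * (1 ⊗ₖ m'))) := by
  have hi : onLeg12 X' * onLeg13 Y' * onLeg23 Z' = onLeg23 Z' * onLeg13 Y' * onLeg12 X' :=
    h.inverse hX hY hZ
  have h1 : onLeg12 X * onLeg12 X' = 1 := by rw [← onLeg12_mul, hX, onLeg12_one]
  have h2 := mul_eq_one_comm.1 h1
  have hc : onLeg12 X * (onLeg23 Z' * onLeg13 Y') = onLeg13 Y' * onLeg23 Z' * onLeg12 X := by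
    calc onLeg12 X * (onLeg23 Z' * onLeg13 Y')
        = onLeg12 X * (onLeg23 Z' * onLeg13 Y' * onLeg12 X') * onLeg12 X := by
          simp only [mul_assoc, h2, mul_one]
      _ = onLeg13 Y' * onLeg23 Z' * onLeg12 X := by
          rw [← hi]; simp only [← mul_assoc, h1, one_mul]
  have hmm : onLeg3 m' * onLeg3 m = 1 := by
    rw [onLeg3, onLeg3, ← onLeg23_mul, ← mul_kronecker_mul, hm, one_mul, one_kronecker_one,
      onLeg23_one]
  have hY' : onLeg13 ((1 ⊗ₖ m) * Y' * (1 ⊗ₖ m')) = onLeg3 m * onLeg13 Y' * onLeg3 m' := by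
    rw [onLeg13_mul, onLeg13_mul, onLeg3_eq_onLeg13, onLeg3_eq_onLeg13]
  have hZ' : onLeg23 ((1 ⊗ₖ m) * Z' * (1 ⊗ₖ m')) = onLeg3 m * onLeg23 Z' * onLeg3 m' := by
    rw [onLeg23_mul, onLeg23_mul, onLeg3, onLeg3]
  have key : onLeg12 X * (onLeg23 ((1 ⊗ₖ m) * Z' * (1 ⊗ₖ m')) *
      onLeg13 ((1 ⊗ₖ m) * Y' * (1 ⊗ₖ m'))) = onLeg13 ((1 ⊗ₖ m) * Y' * (1 ⊗ₖ m')) *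
      onLeg23 ((1 ⊗ₖ m) * Z' * (1 ⊗ₖ m')) * onLeg12 X := by
    rw [hY', hZ']
    calc onLeg12 X * (onLeg3 m * onLeg23 Z' * onLeg3 m' * (onLeg3 m * onLeg13 Y' * onLeg3 m'))
        = onLeg12 X * onLeg3 m * onLeg23 Z' * (onLeg3 m' * onLeg3 m) * onLeg13 Y' *
            onLeg3 m' := by simp only [mul_assoc]
      _ = onLeg3 m * (onLeg12 X * (onLeg23 Z' * onLeg13 Y')) * onLeg3 m' := by
          rw [hmm, onLeg12_mul_onLeg3]; simp only [mul_assoc, one_mul]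
      _ = onLeg3 m * onLeg13 Y' * onLeg23 Z' * (onLeg12 X * onLeg3 m') := by
          rw [hc]; simp only [mul_assoc]
      _ = onLeg3 m * onLeg13 Y' * (onLeg3 m' * onLeg3 m) * onLeg23 Z' * onLeg3 m' *
            onLeg12 X := by
          rw [hmm, onLeg12_mul_onLeg3]; simp only [mul_assoc, one_mul]
      _ = _ := by simp only [mul_assoc]
  have := congrArg transposeThird key
  rw [transposeThird_onLeg12_mul, transposeThird_mul_onLeg12, transposeThird_onLeg13_mul_onLeg23,
    transposeThird_onLeg23_mul_onLeg13, ← mul_assoc] at this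
  exact this

end YangBaxter

end Legs

/-! ### Evaluation of open diagrams -/

/-- The word `w` can be placed on `m` strands. -/
def Fits : ℕ → Word → Prop
  | _, [] => True
  | m, (p, x) :: w => p + x.dom.length ≤ m ∧ Fits (m - x.dom.length + x.cod.length) w

lemma IsTangle.fits {a b : List Bool} {w : Word} (h : IsTangle a w b) : Fits a.length w := by
  induction h with
  | nil => trivial
  | cons l r x w b _ ih =>
    refine ⟨by simp, ?_⟩
    convert ih using 1
    simp only [List.length_append]
    omega

lemma exists_append_of_le_length {β : Type*} {l : List β} {p q : ℕ} (h : p + q ≤ l.length) :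
    ∃ l₁ l₂ l₃, l = l₁ ++ l₂ ++ l₃ ∧ l₁.length = p ∧ l₂.length = q :=
  ⟨l.take p, (l.drop p).take q, (l.drop p).drop q, by simp, by simp; omega, by simp; omega⟩

namespace MatrixModel

open Matrix
open scoped Kronecker

variable {n : ℕ} {k : Type u} [CommRing k] (X : MatrixModel n k)

/-- The sum over all colourings of an open diagram whose input strands are coloured by `cur`. -/
def eval (w : Word) (cur : List (Fin n)) : k :=
  ∑ χ : Marking (Fin n) w, ((critical w cur χ).map X.weight).prod

/-- The contraction of a function of the output colours of a piece with the entries of the piece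
for the input colours `i`. -/
def act (x : Piece) (i : List (Fin n)) (f : List (Fin n) → k) : k :=
  match x, i with
  | .cup s, _ => ∑ a, ∑ b, X.cup s a b * f [a, b]
  | .cap s, [a, b] => X.cap s a b * f []
  | .cross o s t, [c, d] => ∑ a, ∑ b, X.cross o s t a b c d * f [a, b]
  | _, _ => 0

lemma act_congr (x : Piece) (i : List (Fin n)) {f g : List (Fin n) → k}
    (h : ∀ o, o.length = x.cod.length → f o = g o) : X.act x i f = X.act x i g := by
  rcases x with s | s | ⟨o, s, t⟩
  · simp only [act]
    exact Finset.sum_congr rfl fun _ _ => Finset.sum_congr rfl fun _ _ => by rw [h _ rfl]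
  · rcases i with _ | ⟨a, _ | ⟨b, _ | ⟨c, i⟩⟩⟩ <;> simp only [act]
    rw [h _ rfl]
  · rcases i with _ | ⟨a, _ | ⟨b, _ | ⟨c, i⟩⟩⟩ <;> simp only [act]
    exact Finset.sum_congr rfl fun _ _ => Finset.sum_congr rfl fun _ _ => by rw [h _ rfl]

lemma act_cup (s : Bool) (i : List (Fin n)) (f : List (Fin n) → k) :
    X.act (.cup s) i f = ∑ a, ∑ b, X.cup s a b * f [a, b] := rfl

lemma act_cap (s : Bool) (a b : Fin n) (f : List (Fin n) → k) :
    X.act (.cap s) [a, b] f = X.cap s a b * f [] := rfl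

lemma act_cross (o s t : Bool) (c d : Fin n) (f : List (Fin n) → k) :
    X.act (.cross o s t) [c, d] f = ∑ a, ∑ b, X.cross o s t a b c d * f [a, b] := rfl

lemma act_sum {κ : Type*} (S : Finset κ) (x : Piece) (i : List (Fin n))
    (f : κ → List (Fin n) → k) :
    X.act x i (fun o => ∑ j ∈ S, f j o) = ∑ j ∈ S, X.act x i (f j) := by
  rcases x with s | s | ⟨o, s, t⟩ <;>
    rcases i with _ | ⟨a, _ | ⟨b, _ | ⟨c, i⟩⟩⟩ <;> simp only [act, Finset.mul_sum,
      Finset.sum_const_zero]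
  all_goals
    symm
    rw [Finset.sum_comm]
    refine Finset.sum_congr rfl fun _ _ => ?_
    rw [Finset.sum_comm]

lemma act_mul (x : Piece) (i : List (Fin n)) (c : k) (f : List (Fin n) → k) :
    X.act x i (fun o => c * f o) = c * X.act x i f := by
  rcases x with s | s | ⟨o, s, t⟩ <;>
    rcases i with _ | ⟨a, _ | ⟨b, _ | ⟨d, i⟩⟩⟩ <;>
    simp only [act, Finset.mul_sum, mul_left_comm _ c, mul_zero]

lemma act_comm (x y : Piece) (i : List (Fin n)) {j : List (Fin n)} (hj : j.length = y.dom.length)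
    (f : List (Fin n) → List (Fin n) → k) :
    X.act x i (fun o => X.act y j (f o)) = X.act y j (fun o' => X.act x i (fun o => f o o')) := by
  rcases y with s | s | ⟨o, s, t⟩
  · simp only [act_cup, act_sum, act_mul]
  · obtain ⟨a, b, rfl⟩ := List.length_eq_two.1 hj
    simp only [act_cap, act_mul]
  · obtain ⟨a, b, rfl⟩ := List.length_eq_two.1 hj
    simp only [act_cross, act_sum, act_mul]

lemma eval_cons (x : Piece) (w : Word) (l i r : List (Fin n)) (hi : i.length = x.dom.length)
    {p : ℕ} (hp : l.length = p) :
    X.eval ((p, x) :: w) (l ++ i ++ r) = X.act x i fun o => X.eval w (l ++ o ++ r) := by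
  subst hp
  rcases x with s | s | ⟨o, s, t⟩
  · obtain rfl : i = [] := List.length_eq_zero_iff.1 hi
    change ∑ χ : Fin n × Fin n × Marking (Fin n) w, _ = _
    simp [Fintype.sum_prod_type, critical, act, eval, weight, Finset.mul_sum]
  · obtain ⟨a, b, rfl⟩ := List.length_eq_two.1 hi
    change ∑ χ : Marking (Fin n) w, _ = _
    simp [critical, act, eval, weight, Finset.mul_sum]
  · obtain ⟨a, b, rfl⟩ := List.length_eq_two.1 hi
    change ∑ χ : Fin n × Fin n × Marking (Fin n) w, _ = _
    simp [Fintype.sum_prod_type, critical, act, eval, weight, Finset.mul_sum]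

lemma eval_cup (s : Bool) (w : Word) (l r : List (Fin n)) {p : ℕ} (hp : l.length = p) :
    X.eval ((p, .cup s) :: w) (l ++ r) =
      ∑ a, ∑ b, X.cup s a b * X.eval w (l ++ a :: b :: r) := by
  simpa [act] using X.eval_cons (.cup s) w l [] r rfl hp

lemma eval_cap (s : Bool) (w : Word) (l r : List (Fin n)) (a b : Fin n) {p : ℕ}
    (hp : l.length = p) :
    X.eval ((p, .cap s) :: w) (l ++ a :: b :: r) = X.cap s a b * X.eval w (l ++ r) := by
  simpa [act] using X.eval_cons (.cap s) w l [a, b] r rfl hp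

lemma eval_cross (o s t : Bool) (w : Word) (l r : List (Fin n)) (c d : Fin n) {p : ℕ}
    (hp : l.length = p) :
    X.eval ((p, .cross o s t) :: w) (l ++ c :: d :: r) =
      ∑ a, ∑ b, X.cross o s t a b c d * X.eval w (l ++ a :: b :: r) := by
  simpa [act] using X.eval_cons (.cross o s t) w l [c, d] r rfl hp

lemma eval_cup_succ (s : Bool) (w : Word) (l r : List (Fin n)) (e : Fin n) {p : ℕ}
    (hp : l.length = p) :
    X.eval ((1 + p, .cup s) :: w) (l ++ e :: r) =
      ∑ a, ∑ b, X.cup s a b * X.eval w (l ++ e :: a :: b :: r) := by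
  simpa using X.eval_cup s w (l ++ [e]) r (p := 1 + p) (by simp [hp, add_comm])

lemma eval_cap_succ (s : Bool) (w : Word) (l r : List (Fin n)) (e a b : Fin n) {p : ℕ}
    (hp : l.length = p) :
    X.eval ((1 + p, .cap s) :: w) (l ++ e :: a :: b :: r) =
      X.cap s a b * X.eval w (l ++ e :: r) := by
  simpa using X.eval_cap s w (l ++ [e]) r a b (p := 1 + p) (by simp [hp, add_comm])

lemma eval_cross_succ (o s t : Bool) (w : Word) (l r : List (Fin n)) (e c d : Fin n) {p : ℕ}
    (hp : l.length = p) :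
    X.eval ((1 + p, .cross o s t) :: w) (l ++ e :: c :: d :: r) =
      ∑ a, ∑ b, X.cross o s t a b c d * X.eval w (l ++ e :: a :: b :: r) := by
  simpa using X.eval_cross o s t w (l ++ [e]) r c d (p := 1 + p) (by simp [hp, add_comm])

lemma eval_append_congr (u : Word) {L L' : Word}
    (h : ∀ cur : List (Fin n), Fits cur.length L → X.eval L cur = X.eval L' cur)
    (cur : List (Fin n)) (hc : Fits cur.length (u ++ L)) :
    X.eval (u ++ L) cur = X.eval (u ++ L') cur := by
  induction u generalizing cur with
  | nil => exact h cur hc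
  | cons x u ih =>
    obtain ⟨p, x⟩ := x
    obtain ⟨h1, h2⟩ := hc
    obtain ⟨l, i, r, rfl, hl, hi⟩ := exists_append_of_le_length h1
    rw [List.cons_append, List.cons_append, X.eval_cons x _ l i r hi hl,
      X.eval_cons x _ l i r hi hl]
    refine X.act_congr x i fun o ho => ih _ ?_
    change Fits _ (u ++ L) at h2
    convert h2 using 1
    simp only [List.length_append, ho, hi]
    omega

/-! ### Invariance under the moves -/

/-- The entries of a crossing as a matrix: the rows are indexed by the lower ends of `/` and `\`,
the columns by their upper ends. -/
def crossMatrix (o s t : Bool) : Matrix (Fin n × Fin n) (Fin n × Fin n) k :=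
  fun p q => X.cross o s t q.2 q.1 p.1 p.2

/-- The entries of a maximum as a matrix. -/
def turnMatrix (s : Bool) : Matrix (Fin n) (Fin n) k :=
  if s then X.M.val else X.M⁻¹.valᵀ

lemma cap_eq (s : Bool) (a b : Fin n) : X.cap s a b = X.turnMatrix s a b := by
  cases s <;> rfl

lemma cup_eq (s : Bool) (a b : Fin n) : X.cup s a b = X.turnMatrix s b a := by
  cases s <;> rfl

lemma cross_eq (o s t : Bool) (a b c d : Fin n) :
    X.cross o s t a b c d = X.crossMatrix o s t (c, d) (b, a) := rfl

lemma turnMatrix_mul_transpose (s : Bool) : X.turnMatrix s * (X.turnMatrix (!s))ᵀ = 1 := by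
  cases s
  · simp [turnMatrix, ← transpose_mul]
  · simp [turnMatrix]

lemma turnMatrix_transpose_mul (s : Bool) : (X.turnMatrix s)ᵀ * X.turnMatrix (!s) = 1 := by
  cases s
  · simp [turnMatrix]
  · simp [turnMatrix, ← transpose_mul]

/-- The conditions on the crossing matrices which correspond to the moves. -/
structure RespectsMoves : Prop where
  two (o s t : Bool) : X.crossMatrix o s t * swapFactors (X.crossMatrix (!o) t s) = 1
  switchback (o s r : Bool) :
    (X.turnMatrix s ⊗ₖ 1) * transposeFst (swapFactors (X.crossMatrix (!o) r !s)) =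
      X.crossMatrix o s r * (X.turnMatrix s ⊗ₖ 1)
  three (a b c s t r : Bool) (h : ¬ (a = c ∧ b ≠ a)) :
    YangBaxter (X.crossMatrix a s t) (X.crossMatrix b s r) (X.crossMatrix c t r)

variable {X}

lemma RespectsMoves.switchback_apply (hX : X.RespectsMoves) (o s r : Bool) (c d a f : Fin n) :
    ∑ e, X.turnMatrix s c e * X.crossMatrix (!o) r (!s) (d, f) (a, e) =
      ∑ b, X.crossMatrix o s r (c, d) (b, a) * X.turnMatrix s b f := by
  have := congrFun (congrFun (hX.switchback o s r) (c, d)) (f, a)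
  simpa [mul_apply, Fintype.sum_prod_type, one_apply, transposeFst, swapFactors] using this

lemma RespectsMoves.switchback_apply' (hX : X.RespectsMoves) (o s r : Bool) (d w q p : Fin n) :
    ∑ x, X.turnMatrix s w x * X.crossMatrix o r s (d, x) (q, p) =
      ∑ y, X.crossMatrix (!o) (!s) r (y, d) (w, q) * X.turnMatrix s y p := by
  have h := hX.switchback (!o) (!s) r
  rw [Bool.not_not, Bool.not_not] at h
  set A := transposeFst (swapFactors (X.crossMatrix o r s))
  have h1 : (X.turnMatrix s)ᵀ ⊗ₖ (1 : Matrix (Fin n) (Fin n) k) *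
      (X.turnMatrix (!s) ⊗ₖ 1) = 1 := by
    rw [← mul_kronecker_mul, X.turnMatrix_transpose_mul, one_mul, one_kronecker_one]
  have h2 := mul_eq_one_comm.1 h1
  have h3 : A * ((X.turnMatrix s)ᵀ ⊗ₖ 1) =
      ((X.turnMatrix s)ᵀ ⊗ₖ 1) * X.crossMatrix (!o) (!s) r := by
    calc A * ((X.turnMatrix s)ᵀ ⊗ₖ 1)
        = ((X.turnMatrix s)ᵀ ⊗ₖ 1) * (X.turnMatrix (!s) ⊗ₖ 1 * A) *
            ((X.turnMatrix s)ᵀ ⊗ₖ 1) := by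
          rw [← mul_assoc, h1, one_mul]
      _ = _ := by rw [h, ← mul_assoc, mul_assoc, h2, mul_one]
  have h4 := congrFun (congrFun h3 (p, d)) (w, q)
  simp only [A, mul_apply, Fintype.sum_prod_type, one_apply, transposeFst, swapFactors,
    kroneckerMap_apply, submatrix_apply, transpose_apply, Prod.swap, mul_ite, mul_one, mul_zero,
    ite_mul, zero_mul, Finset.sum_ite_eq, Finset.sum_ite_eq', Finset.mem_univ, if_true] at h4
  simpa only [mul_comm] using h4

lemma RespectsMoves.two_apply (hX : X.RespectsMoves) (o s t : Bool) (c d : Fin n)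
    (f : Fin n → Fin n → k) :
    ∑ a, ∑ b, X.crossMatrix o s t (c, d) (b, a) *
      ∑ a', ∑ b', X.crossMatrix (!o) t s (a, b) (b', a') * f a' b' = f c d := by
  have h : X.crossMatrix o s t *ᵥ (swapFactors (X.crossMatrix (!o) t s) *ᵥ fun p => f p.1 p.2) =
      fun p => f p.1 p.2 := by
    rw [mulVec_mulVec, hX.two, one_mulVec]
  rw [Finset.sum_comm]
  simpa [mulVec, dotProduct, Fintype.sum_prod_type, swapFactors] using congrFun h (c, d)

lemma RespectsMoves.three_apply (hX : X.RespectsMoves) (a b c s t r : Bool)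
    (h : ¬ (a = c ∧ b ≠ a)) (i j l : Fin n) (f : Fin n → Fin n → Fin n → k) :
    ∑ x₂, ∑ x₁, X.crossMatrix a s t (i, j) (x₁, x₂) *
      ∑ x₃, ∑ y₁, X.crossMatrix b s r (x₁, l) (y₁, x₃) *
        ∑ y₃, ∑ y₂, X.crossMatrix c t r (x₂, x₃) (y₂, y₃) * f y₃ y₂ y₁ =
    ∑ x₃, ∑ x₂, X.crossMatrix c t r (j, l) (x₂, x₃) *
      ∑ y₃, ∑ x₁, X.crossMatrix b s r (i, x₃) (x₁, y₃) *
        ∑ y₂, ∑ y₁, X.crossMatrix a s t (x₁, x₂) (y₁, y₂) * f y₃ y₂ y₁ := by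
  have := congrFun (congrArg (· *ᵥ fun p : Fin n × Fin n × Fin n => f p.2.2 p.2.1 p.1)
    (hX.three a b c s t r h)) (i, j, l)
  simpa only [← mulVec_mulVec, onLeg12_mulVec, onLeg13_mulVec, onLeg23_mulVec] using this

lemma RespectsMoves.switchback_cup (hX : X.RespectsMoves) (o s r : Bool) (d : Fin n)
    (f : Fin n → Fin n → Fin n → k) :
    ∑ x, ∑ w, X.turnMatrix s w x *
      ∑ p, ∑ q, X.crossMatrix o r s (d, x) (q, p) * f p q w =
    ∑ p, ∑ y, X.turnMatrix s y p *
      ∑ q, ∑ w, X.crossMatrix (!o) (!s) r (y, d) (w, q) * f p q w := by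
  trans ∑ w, ∑ p, ∑ q,
    (∑ x, X.turnMatrix s w x * X.crossMatrix o r s (d, x) (q, p)) * f p q w
  · rw [Finset.sum_comm]
    refine Finset.sum_congr rfl fun w _ => ?_
    simp only [Finset.mul_sum, Finset.sum_mul, mul_assoc]
    exact Finset.sum_comm_cycle.symm
  · simp only [hX.switchback_apply', Finset.mul_sum, Finset.sum_mul]
    rw [Finset.sum_comm]
    refine Finset.sum_congr rfl fun p _ => ?_
    rw [← Finset.sum_comm_cycle, Finset.sum_comm]
    exact Finset.sum_congr rfl fun _ _ => Finset.sum_congr rfl fun _ _ =>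
      Finset.sum_congr rfl fun _ _ => by ring

/-- Evaluating either side of a move gives the same result. -/
lemma RespectsMoves.eval_move (hX : X.RespectsMoves) {L L' : Word} (h : Move L L') (p : ℕ)
    (v : Word) (cur : List (Fin n)) (hc : Fits cur.length (shift p L ++ v)) :
    X.eval (shift p L ++ v) cur = X.eval (shift p L' ++ v) cur := by
  cases h with
  | interchange x y m =>
    obtain ⟨h1, h2, -⟩ := hc
    obtain ⟨l, i, r, rfl, hl, hi⟩ := exists_append_of_le_length (p := p) (q := x.dom.length)
      (by simpa using h1)
    obtain ⟨q, j, r, rfl, hq, hj⟩ := exists_append_of_le_length (p := m) (q := y.dom.length)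
      (l := r) (by simp at h2; omega)
    simp only [shift, List.map_cons, List.map_nil, List.cons_append, List.nil_append, zero_add]
    have hL : ∀ o : List (Fin n), o.length = x.cod.length →
        X.eval ((x.cod.length + m + p, y) :: v) (l ++ o ++ (q ++ j ++ r)) =
          X.act y j fun o' => X.eval v (l ++ o ++ q ++ o' ++ r) := by
      intro o ho
      rw [← X.eval_cons y v (l ++ o ++ q) j r hj (p := x.cod.length + m + p) (by simp; omega)]
      simp only [List.append_assoc]
    rw [X.eval_cons x _ l i _ hi hl, X.act_congr x i hL, X.act_comm x y i hj,
      show l ++ i ++ (q ++ j ++ r) = (l ++ i ++ q) ++ j ++ r by simp only [List.append_assoc],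
      X.eval_cons y _ (l ++ i ++ q) j r hj (by simp; omega)]
    congr 1
    funext o'
    rw [show l ++ i ++ q ++ o' ++ r = l ++ i ++ (q ++ o' ++ r) by simp only [List.append_assoc],
      X.eval_cons x v l i _ hi hl]
    simp only [List.append_assoc]
  | zigzag_left s =>
    obtain ⟨h1, h2, -⟩ := hc
    obtain ⟨l, i, r, rfl, hl, hi⟩ := exists_append_of_le_length (l := cur) (p := p) (q := 1) (by
      simp [Piece.dom, Piece.cod] at h2; omega)
    obtain ⟨d, rfl⟩ := List.length_eq_one_iff.1 hi
    simp only [shift, List.map_cons, List.map_nil, List.cons_append, List.nil_append, zero_add,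
      List.append_assoc, X.eval_cup s _ l _ hl, X.eval_cap_succ (!s) v l _ _ _ _ hl,
      cup_eq, cap_eq]
    have h := fun a => congrFun (congrFun (X.turnMatrix_transpose_mul s) a) d
    simp only [mul_apply, transpose_apply] at h
    simp only [← mul_assoc, ← Finset.sum_mul, h, one_apply, ite_mul, one_mul, zero_mul,
      Finset.sum_ite_eq', Finset.mem_univ, if_true]
  | zigzag_right s =>
    obtain ⟨h1, h2, -⟩ := hc
    obtain ⟨l, i, r, rfl, hl, hi⟩ := exists_append_of_le_length (l := cur) (p := p) (q := 1) (by
      simp [Piece.dom] at h1; omega)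
    obtain ⟨d, rfl⟩ := List.length_eq_one_iff.1 hi
    simp only [shift, List.map_cons, List.map_nil, List.cons_append, List.nil_append, zero_add,
      List.append_assoc, X.eval_cup_succ (!s) _ l _ _ hl, X.eval_cap s v l _ _ _ hl,
      cup_eq, cap_eq]
    have h := fun b => congrFun (congrFun (X.turnMatrix_mul_transpose s) d) b
    simp only [mul_apply, transpose_apply] at h
    rw [Finset.sum_comm]
    simp only [mul_left_comm (X.turnMatrix (!s) _ _)]
    simp only [← mul_assoc, ← Finset.sum_mul, h, one_apply, ite_mul, one_mul, zero_mul,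
      Finset.sum_ite_eq, Finset.mem_univ, if_true]
  | two o s t =>
    obtain ⟨h1, -⟩ := hc
    obtain ⟨l, i, r, rfl, hl, hi⟩ := exists_append_of_le_length (l := cur) (p := p) (q := 2) (by
      simpa [Piece.dom] using h1)
    obtain ⟨c, d, rfl⟩ := List.length_eq_two.1 hi
    simp only [shift, List.map_cons, List.map_nil, List.cons_append, List.nil_append, zero_add,
      List.append_assoc, X.eval_cross _ _ _ _ l _ _ _ hl, cross_eq]
    exact hX.two_apply o s t c d fun a b => X.eval v (l ++ a :: b :: r)
  | three a b c s t r h =>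
    obtain ⟨h1, h2, -⟩ := hc
    obtain ⟨l, i, q, rfl, hl, hi⟩ := exists_append_of_le_length (l := cur) (p := p) (q := 3) (by
      simp [Piece.dom, Piece.cod] at h1 h2; omega)
    obtain ⟨c, d, e, rfl⟩ := List.length_eq_three.1 hi
    simp only [shift, List.map_cons, List.map_nil, List.cons_append, List.nil_append, zero_add,
      List.append_assoc, X.eval_cross _ _ _ _ l _ _ _ hl, X.eval_cross_succ _ _ _ _ l _ _ _ _ hl,
      cross_eq]
    exact hX.three_apply _ _ _ s t r h c d e fun x y z => X.eval v (l ++ x :: y :: z :: q)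
  | four_cap o s r =>
    obtain ⟨h1, h2, -⟩ := hc
    obtain ⟨l, i, q, rfl, hl, hi⟩ := exists_append_of_le_length (l := cur) (p := p) (q := 3) (by
      simp [Piece.dom, Piece.cod] at h1 h2; omega)
    obtain ⟨c, d, e, rfl⟩ := List.length_eq_three.1 hi
    simp only [shift, List.map_cons, List.map_nil, List.cons_append, List.nil_append, zero_add,
      List.append_assoc, X.eval_cross _ _ _ _ l _ _ _ hl, X.eval_cross_succ _ _ _ _ l _ _ _ _ hl,
      X.eval_cap _ _ l _ _ _ hl, X.eval_cap_succ _ _ l _ _ _ _ hl, cross_eq, cap_eq]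
    rw [Finset.sum_comm (γ := Fin n) (f := fun a b => X.crossMatrix (!o) r (!s) _ (b, a) * _)]
    refine Finset.sum_congr rfl fun a _ => ?_
    simp only [← mul_assoc, ← Finset.sum_mul]
    rw [← hX.switchback_apply]
    simp only [mul_comm]
  | four_cup o s r =>
    obtain ⟨h1, h2, -⟩ := hc
    obtain ⟨l, i, q, rfl, hl, hi⟩ := exists_append_of_le_length (l := cur) (p := p) (q := 1) (by
      simp [Piece.dom] at h1; omega)
    obtain ⟨d, rfl⟩ := List.length_eq_one_iff.1 hi
    simp only [shift, List.map_cons, List.map_nil, List.cons_append, List.nil_append, zero_add,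
      List.append_assoc, X.eval_cross _ _ _ _ l _ _ _ hl, X.eval_cross_succ _ _ _ _ l _ _ _ _ hl,
      X.eval_cup _ _ l _ hl, X.eval_cup_succ _ _ l _ _ hl, cross_eq, cup_eq]
    exact hX.switchback_cup o s r d fun x y z => X.eval v (l ++ x :: y :: z :: q)

lemma RespectsMoves.Z_eq_of_regularIsotopic (hX : X.RespectsMoves) {K K' : LinkDiagram}
    (h : K.RegularIsotopic K') : X.Z K = X.Z K' := by
  induction h with
  | rel K K' h =>
    obtain ⟨u, v, p, L, L', hm, h1, h2⟩ := h
    change X.eval K.word [] = X.eval K'.word []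
    have hf := K.closed.fits
    rw [h1, List.append_assoc] at hf
    rw [h1, h2, List.append_assoc, List.append_assoc]
    exact X.eval_append_congr u (hX.eval_move hm p v) [] hf
  | refl => rfl
  | symm _ _ _ ih => exact ih.symm
  | trans _ _ _ _ _ ih1 ih2 => exact ih1.trans ih2

end MatrixModel

/-! ### Matrix models which satisfy the moves -/

namespace MatrixModel

open Matrix
open scoped Kronecker

variable {n : ℕ} {k : Type u} [CommRing k] (X : MatrixModel n k)

/-- The relations between the matrices `Y o` of the two upward crossings, their inverses `Y' o` and
`M` from which all moves follow. -/
structure IsBalanced (Y Y' : Bool → Matrix (Fin n × Fin n) (Fin n × Fin n) k) : Prop where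
  up o : X.crossMatrix o true true = Y o
  down o : X.crossMatrix o false false = (Y o)ᵀ
  right o : X.crossMatrix o true false =
    transposeSnd ((X.M.val ⊗ₖ 1) * Y' o * (X.M⁻¹.val ⊗ₖ 1))
  left o : X.crossMatrix o false true =
    transposeFst ((X.M.val ⊗ₖ 1) * Y' o * (X.M⁻¹.val ⊗ₖ 1))
  mul_inv o : Y o * Y' o = 1
  swap o : swapFactors (Y (!o)) = Y' o
  conj o : ((1 ⊗ₖ X.M.val) * Y o * (1 ⊗ₖ X.M⁻¹.val)) =
    ((X.M⁻¹.val ⊗ₖ 1) * Y o * (X.M.val ⊗ₖ 1))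
  op o : transposeSnd ((1 ⊗ₖ X.M.val) * Y o * (1 ⊗ₖ X.M⁻¹.val)) *
    transposeSnd ((X.M.val ⊗ₖ 1) * Y' o * (X.M⁻¹.val ⊗ₖ 1)) = 1
  yang_baxter : YangBaxter (Y true) (Y true) (Y true)

namespace IsBalanced

variable {X} {Y Y' : Bool → Matrix (Fin n × Fin n) (Fin n × Fin n) k} (h : X.IsBalanced Y Y')

include h

lemma swap' (o : Bool) : swapFactors (Y' (!o)) = Y o := by
  rw [← h.swap, Bool.not_not, swapFactors_swapFactors]

lemma swap_conj (o : Bool) :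
    swapFactors ((X.M.val ⊗ₖ 1) * Y' (!o) * (X.M⁻¹.val ⊗ₖ 1)) =
      (1 ⊗ₖ X.M.val) * Y o * (1 ⊗ₖ X.M⁻¹.val) := by
  rw [swapFactors_mul, swapFactors_mul, swapFactors_kronecker, swapFactors_kronecker, h.swap']

lemma two (o s t : Bool) : X.crossMatrix o s t * swapFactors (X.crossMatrix (!o) t s) = 1 := by
  cases s <;> cases t
  · rw [h.down, h.down, swapFactors_transpose, h.swap, ← transpose_mul,
      mul_eq_one_comm.1 (h.mul_inv o), transpose_one]
  · rw [h.left, h.right, swapFactors_transposeSnd, h.swap_conj, transposeFst_eq, transposeFst_eq,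
      ← transpose_mul, h.op, transpose_one]
  · rw [h.left, h.right, swapFactors_transposeFst, h.swap_conj, mul_eq_one_comm.1 (h.op o)]
  · rw [h.up, h.up, h.swap, h.mul_inv]

lemma switchback (o s r : Bool) :
    (X.turnMatrix s ⊗ₖ 1) * transposeFst (swapFactors (X.crossMatrix (!o) r !s)) =
      X.crossMatrix o s r * (X.turnMatrix s ⊗ₖ 1) := by
  have h1 : (X.M⁻¹.val ⊗ₖ (1 : Matrix (Fin n) (Fin n) k)) * (X.M.val ⊗ₖ 1) = 1 := by
    rw [← mul_kronecker_mul, Units.inv_mul, one_mul, one_kronecker_one]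
  have h2 := mul_eq_one_comm.1 h1
  cases s <;> cases r <;> simp only [turnMatrix, Bool.not_true, Bool.not_false, if_true,
    Bool.false_eq_true, if_false]
  · rw [h.left, h.down, swapFactors_transposeFst, h.swap_conj, transposeFst_eq,
      transposeSnd_transposeSnd, h.conj, show (X.M⁻¹.valᵀ ⊗ₖ (1 : Matrix (Fin n) (Fin n) k)) =
        (X.M⁻¹.val ⊗ₖ 1)ᵀ by rw [← kroneckerMap_transpose, transpose_one], ← transpose_mul,
      ← transpose_mul, mul_assoc, h2, mul_one]
  · rw [h.up, h.left, h.swap, transposeFst_conj, mul_assoc _ (X.M.valᵀ ⊗ₖ 1), ← mul_kronecker_mul,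
      ← transpose_mul, Units.inv_mul, transpose_one, one_mul, one_kronecker_one, mul_one]
  · rw [h.down, h.right, swapFactors_transpose, h.swap, transposeSnd_conj, mul_assoc _ _
      (X.M.val ⊗ₖ 1), h1, mul_one]
    rfl
  · rw [h.up, h.right, swapFactors_transposeSnd, h.swap_conj, transposeFst_transposeFst, h.conj,
      mul_assoc (X.M⁻¹.val ⊗ₖ 1), ← mul_assoc (X.M.val ⊗ₖ 1), h2, one_mul]

lemma transpose (o s t : Bool) : X.crossMatrix o (!s) (!t) = (X.crossMatrix o s t)ᵀ := by
  cases s <;> cases t <;> simp only [Bool.not_true, Bool.not_false, h.up, h.down, h.left, h.right,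
    transpose_transpose, transposeFst_eq]

lemma three_up (a b c : Bool) (hn : ¬ (a = c ∧ b ≠ a)) : YangBaxter (Y a) (Y b) (Y c) := by
  have last {a b : Bool} {c : Bool} (H : YangBaxter (Y a) (Y b) (Y (!c))) :
      YangBaxter (Y b) (Y a) (Y c) := by
    rw [← h.swap' c]; exact H.swap_last (h.mul_inv _)
  have first {a b c : Bool} (H : YangBaxter (Y (!a)) (Y b) (Y c)) :
      YangBaxter (Y a) (Y c) (Y b) := by
    rw [← h.swap' a]; exact H.swap_first (h.mul_inv _)
  have h0 := h.yang_baxter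
  have h1 : YangBaxter (Y true) (Y true) (Y false) := last h0
  have h2 : YangBaxter (Y false) (Y true) (Y true) := first h0
  have h3 : YangBaxter (Y false) (Y false) (Y true) := first h1
  have h4 : YangBaxter (Y true) (Y false) (Y false) := last h2
  have h5 : YangBaxter (Y false) (Y false) (Y false) := last h3
  match a, b, c with
  | true, true, true => exact h0
  | true, true, false => exact h1
  | false, true, true => exact h2
  | false, false, true => exact h3
  | true, false, false => exact h4
  | false, false, false => exact h5
  | true, false, true => exact absurd (by decide) hn
  | false, true, false => exact absurd (by decide) hn

/-- The third move for strands of given orientations. -/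
lemma three (a b c s t r : Bool) (hn : ¬ (a = c ∧ b ≠ a)) :
    YangBaxter (X.crossMatrix a s t) (X.crossMatrix b s r) (X.crossMatrix c t r) := by
  let H (s t r : Bool) : Prop := ∀ a b c, ¬ (a = c ∧ b ≠ a) →
    YangBaxter (X.crossMatrix a s t) (X.crossMatrix b s r) (X.crossMatrix c t r)
  have last (s t r : Bool) (H' : H s t r) : H s t (!r) := by
    intro a b c hn
    have rev (o s : Bool) : X.crossMatrix o s (!r) = transposeSnd ((1 ⊗ₖ (X.turnMatrix (!r))ᵀ) *
        swapFactors (X.crossMatrix (!o) r s) * (1 ⊗ₖ X.turnMatrix r)) := by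
      have h1 := congrArg swapFactors (h.switchback (!o) r s)
      rw [Bool.not_not, swapFactors_mul, swapFactors_mul, swapFactors_kronecker,
        swapFactors_transposeFst, swapFactors_swapFactors] at h1
      rw [mul_assoc, ← h1, ← mul_assoc, ← mul_kronecker_mul,
        mul_eq_one_comm.1 (X.turnMatrix_mul_transpose r), one_mul, one_kronecker_one, one_mul,
        transposeSnd_transposeSnd]
    rw [rev b s, rev c t]
    exact (H' a b c hn).reverse_third (h.two _ _ _) (h.two _ _ _) (h.two _ _ _)
      (X.turnMatrix_mul_transpose r)
  have outer (s t r : Bool) (H' : H s t r) : H r t s := by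
    intro a b c hn
    have hi (o s t : Bool) : swapFactors (X.crossMatrix (!o) s t) * X.crossMatrix o t s = 1 :=
      mul_eq_one_comm.1 (h.two o t s)
    refine (H' (!c) (!b) (!a) ?_).swap_outer.inverse (hi _ _ _) (hi _ _ _) (hi _ _ _)
    rintro ⟨h1, h2⟩
    obtain rfl : c = a := Bool.not_inj h1
    exact hn ⟨rfl, fun e => h2 (congrArg Bool.not e)⟩
  have all (s t r : Bool) (H' : H s t r) : H (!s) (!t) (!r) := by
    intro a b c hn
    rw [h.transpose, h.transpose, h.transpose]
    exact (H' a b c hn).transpose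
  have h0 : H true true true := by
    intro a b c hn
    rw [h.up, h.up, h.up]
    exact h.three_up a b c hn
  have h1 : H true true false := last true true true h0
  have h2 : H false true true := outer true true false h1
  have h3 : H false true false := last false true true h2
  have h4 : H false false false := all true true true h0
  have h5 : H false false true := all true true false h1
  have h6 : H true false false := all false true true h2
  have h7 : H true false true := all false true false h3
  match s, t, r with
  | true, true, true => exact h0 a b c hn
  | true, true, false => exact h1 a b c hn
  | false, true, true => exact h2 a b c hn
  | false, true, false => exact h3 a b c hn
  | false, false, false => exact h4 a b c hn
  | false, false, true => exact h5 a b c hn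
  | true, false, false => exact h6 a b c hn
  | true, false, true => exact h7 a b c hn

lemma respectsMoves : X.RespectsMoves := ⟨h.two, h.switchback, h.three⟩

end IsBalanced

lemma isBalanced_of_matrix {P P' : Matrix (Fin n × Fin n) (Fin n × Fin n) k}
    (hR : ∀ a b c d, X.R a b c d = P (c, d) (b, a))
    (hS : ∀ a b c d, X.S a b c d = P' (d, c) (a, b)) (hP : P * P' = 1)
    (hM : (X.M.val ⊗ₖ X.M.val) * P * (X.M⁻¹.val ⊗ₖ X.M⁻¹.val) = P)
    (hop : transposeSnd ((1 ⊗ₖ X.M.val) * P * (1 ⊗ₖ X.M⁻¹.val)) *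
      transposeSnd ((X.M.val ⊗ₖ 1) * P' * (X.M⁻¹.val ⊗ₖ 1)) = 1)
    (hYB : YangBaxter P P P) :
    X.IsBalanced (fun o => if o then P else swapFactors P')
      (fun o => if o then P' else swapFactors P) := by
  have h1 : (X.M⁻¹.val ⊗ₖ (1 : Matrix (Fin n) (Fin n) k)) * (X.M.val ⊗ₖ 1) = 1 := by
    rw [← mul_kronecker_mul, Units.inv_mul, one_mul, one_kronecker_one]
  have h2 : ((1 : Matrix (Fin n) (Fin n) k) ⊗ₖ X.M⁻¹.val) * (1 ⊗ₖ X.M.val) = 1 := by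
    rw [← mul_kronecker_mul, Units.inv_mul, one_mul, one_kronecker_one]
  have h3 : X.M.val ⊗ₖ X.M.val = (X.M.val ⊗ₖ 1) * (1 ⊗ₖ X.M.val) := by
    rw [← mul_kronecker_mul, one_mul, mul_one]
  have h4 : X.M⁻¹.val ⊗ₖ X.M⁻¹.val = (1 ⊗ₖ X.M⁻¹.val) * (X.M⁻¹.val ⊗ₖ 1) := by
    rw [← mul_kronecker_mul, one_mul, mul_one]
  have hconj (W : Matrix (Fin n × Fin n) (Fin n × Fin n) k)
      (hW : (X.M.val ⊗ₖ X.M.val) * W * (X.M⁻¹.val ⊗ₖ X.M⁻¹.val) = W) :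
      (1 ⊗ₖ X.M.val) * W * (1 ⊗ₖ X.M⁻¹.val) = (X.M⁻¹.val ⊗ₖ 1) * W * (X.M.val ⊗ₖ 1) := by
    conv_rhs => rw [← hW, h3, h4]
    simp only [mul_assoc, h1, mul_one]
    rw [← mul_assoc (X.M⁻¹.val ⊗ₖ 1), h1, one_mul]
  have h5 : (X.M⁻¹.val ⊗ₖ X.M⁻¹.val) * (X.M.val ⊗ₖ X.M.val) = 1 := by
    rw [← mul_kronecker_mul, Units.inv_mul, one_kronecker_one]
  have hM' : (X.M.val ⊗ₖ X.M.val) * P' * (X.M⁻¹.val ⊗ₖ X.M⁻¹.val) = P' := by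
    refine (left_inv_eq_right_inv (a := P) (mul_eq_one_comm.1 hP) ?_).symm
    calc P * ((X.M.val ⊗ₖ X.M.val) * P' * (X.M⁻¹.val ⊗ₖ X.M⁻¹.val))
        = (X.M.val ⊗ₖ X.M.val) * P * ((X.M⁻¹.val ⊗ₖ X.M⁻¹.val) * (X.M.val ⊗ₖ X.M.val)) * P' *
            (X.M⁻¹.val ⊗ₖ X.M⁻¹.val) := by
          conv_lhs => rw [← hM]
          simp only [mul_assoc]
      _ = 1 := by rw [h5, mul_one, mul_assoc _ P, hP, mul_one, mul_eq_one_comm.1 h5]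
  have hM'' : (X.M.val ⊗ₖ X.M.val) * swapFactors P' * (X.M⁻¹.val ⊗ₖ X.M⁻¹.val) =
      swapFactors P' := by
    conv_rhs => rw [← hM']
    rw [swapFactors_mul, swapFactors_mul, swapFactors_kronecker, swapFactors_kronecker]
  have hswop : transposeSnd ((1 ⊗ₖ X.M.val) * swapFactors P' * (1 ⊗ₖ X.M⁻¹.val)) *
      transposeSnd ((X.M.val ⊗ₖ 1) * swapFactors P * (X.M⁻¹.val ⊗ₖ 1)) = 1 := by
    have := congrArg (fun W => swapFactors Wᵀ) hop
    simpa only [transpose_mul, ← transposeFst_eq, swapFactors_mul, swapFactors_transposeFst,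
      swapFactors_kronecker, transpose_one, swapFactors_one] using this
  constructor
  · rintro (_ | _) <;> ext ⟨c, d⟩ ⟨b, a⟩
    · simp [crossMatrix, cross, hS, swapFactors]
    · simp [crossMatrix, cross, hR]
  · rintro (_ | _) <;> ext ⟨c, d⟩ ⟨b, a⟩
    · simp [crossMatrix, cross, hS, swapFactors]
    · simp [crossMatrix, cross, hR]
  · rintro (_ | _) <;> ext ⟨c, d⟩ ⟨b, a⟩ <;>
      simp [crossMatrix, cross, hR, hS, swapFactors, transposeSnd, mul_apply, cap, cup,
        Fintype.sum_prod_type, one_apply, Finset.sum_mul] <;> rw [Finset.sum_comm]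
  · rintro (_ | _) <;> ext ⟨c, d⟩ ⟨b, a⟩ <;>
      simp [crossMatrix, cross, hR, hS, swapFactors, transposeFst, mul_apply, cap, cup,
        Fintype.sum_prod_type, one_apply, Finset.sum_mul] <;>
      exact Finset.sum_congr rfl fun _ _ => Finset.sum_congr rfl fun _ _ => by ring
  · rintro (_ | _)
    · simpa [swapFactors_one, swapFactors_mul] using
        congrArg swapFactors (mul_eq_one_comm.1 hP)
    · simpa using hP
  · rintro (_ | _) <;> simp
  · rintro (_ | _)
    · simpa using hconj _ hM''
    · simpa using hconj _ hM
  · rintro (_ | _)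
    · simpa using hswop
    · simpa using hop
  · simpa using hYB

end MatrixModel

/-! ### The image of an oriented quantum algebra under a representation -/

section Representation

open Matrix
open scoped Kronecker

variable {k : Type u} [CommRing k] {A : Type*} {B : Type*} [Ring A] [Algebra k A] [Ring B]
  [Algebra k B] {ι κ : Type*} [Fintype ι] [DecidableEq ι] [Fintype κ] [DecidableEq κ]

/-- The Kronecker product of two matrix representations. -/
noncomputable def kroneckerRep (f : A →ₐ[k] Matrix ι ι k) (g : B →ₐ[k] Matrix κ κ k) :
    A ⊗[k] B →ₐ[k] Matrix (ι × κ) (ι × κ) k :=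
  Algebra.TensorProduct.algHomOfLinearMapTensorProduct
    (TensorProduct.lift ((kroneckerBilinear (R := k) (α := k)).compl₁₂ f.toLinearMap g.toLinearMap))
    (fun a a' b b' => by simp [kroneckerBilinear, ← mul_kronecker_mul])
    (by simp [kroneckerBilinear])

@[simp] lemma kroneckerRep_tmul (f : A →ₐ[k] Matrix ι ι k) (g : B →ₐ[k] Matrix κ κ k) (a : A)
    (b : B) : kroneckerRep f g (a ⊗ₜ b) = f a ⊗ₖ g b := by
  simp [kroneckerRep, kroneckerBilinear]

/-- The transposed representation of the opposite algebra. -/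
noncomputable def transposeRep (f : A →ₐ[k] Matrix ι ι k) : Aᵐᵒᵖ →ₐ[k] Matrix ι ι k :=
  ((transposeAlgEquiv ι k k).symm : (Matrix ι ι k)ᵐᵒᵖ →ₐ[k] Matrix ι ι k).comp f.op

@[simp] lemma transposeRep_op (f : A →ₐ[k] Matrix ι ι k) (a : A) :
    transposeRep f (MulOpposite.op a) = (f a)ᵀ := rfl

variable (f : A →ₐ[k] Matrix ι ι k)

lemma kroneckerRep_toOp (x : A ⊗[k] A) :
    kroneckerRep f (transposeRep f) (toOp k A x) = transposeSnd (kroneckerRep f f x) := by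
  induction x with
  | zero => simp; rfl
  | tmul a b => simp [toOp]; rfl
  | add x y hx hy => rw [map_add, map_add, map_add, hx, hy]; rfl

lemma kroneckerRep_leg12 (x : A ⊗[k] A) :
    kroneckerRep f (kroneckerRep f f) (leg12 k A x) = onLeg12 (kroneckerRep f f x) := by
  induction x with
  | zero => ext; simp [onLeg12]
  | tmul a b => ext ⟨i, j, l⟩ ⟨i', j', l'⟩; simp [leg12, onLeg12, mul_assoc]
  | add x y hx hy => rw [map_add, map_add, map_add, hx, hy]; ext; simp [onLeg12, add_mul]

lemma kroneckerRep_leg13 (x : A ⊗[k] A) :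
    kroneckerRep f (kroneckerRep f f) (leg13 k A x) = onLeg13 (kroneckerRep f f x) := by
  induction x with
  | zero => ext; simp [onLeg13]
  | tmul a b =>
    ext ⟨i, j, l⟩ ⟨i', j', l'⟩
    simp [leg13, onLeg13, mul_comm, mul_left_comm]
  | add x y hx hy => rw [map_add, map_add, map_add, hx, hy]; ext; simp [onLeg13, add_mul]

lemma kroneckerRep_leg23 (x : A ⊗[k] A) :
    kroneckerRep f (kroneckerRep f f) (leg23 k A x) = onLeg23 (kroneckerRep f f x) := by
  induction x with
  | zero => ext; simp [onLeg23]
  | tmul a b =>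
    ext ⟨i, j, l⟩ ⟨i', j', l'⟩
    simp [leg23, onLeg23, mul_comm]
  | add x y hx hy => rw [map_add, map_add, map_add, hx, hy]; ext; simp [onLeg23, add_mul]

/-- Representations of algebra automorphisms by conjugation. -/
lemma kroneckerRep_map (S T : A →ₐ[k] A) {m m' p p' : Matrix ι ι k}
    (hS : ∀ a, f (S a) = m * f a * m') (hT : ∀ a, f (T a) = p * f a * p') (x : A ⊗[k] A) :
    kroneckerRep f f (Algebra.TensorProduct.map S T x) =
      (m ⊗ₖ p) * kroneckerRep f f x * (m' ⊗ₖ p') := by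
  induction x with
  | zero => simp
  | tmul a b => simp [hS, hT, mul_kronecker_mul]
  | add x y hx hy => rw [map_add, map_add, map_add, hx, hy, mul_add, add_mul]

lemma tensorEntry_map {n : ℕ} (f : A →ₐ[k] Matrix (Fin n) (Fin n) k) (x : A ⊗[k] A)
    (a b c d : Fin n) :
    tensorEntry (Algebra.TensorProduct.map f f x) a b c d =
      kroneckerRep f f x (c, d) (a, b) := by
  induction x with
  | zero => simp [tensorEntry]
  | tmul x y => simp [tensorEntry]
  | add x y hx hy =>
    simp only [tensorEntry, map_add, Matrix.add_apply] at hx hy ⊢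
    rw [hx, hy]

end Representation

section Image

open Matrix
open scoped Kronecker

variable {k : Type u} [CommRing k] {A : Type v} [Ring A] [Algebra k A]
  (Q : OrientedQuantumAlgebra k A) {n : ℕ} (Rep : A →ₐ[k] Matrix (Fin n) (Fin n) k)
  (M : (Matrix (Fin n) (Fin n) k)ˣ)

/-- The matrix model of a balanced oriented quantum algebra satisfies the moves. -/
lemma respectsMoves_matrixModel (hQ : Q.Balanced)
    (hM : ∀ a : A, Rep (Q.U a) = M.val * Rep a * M⁻¹.val) :
    (matrixModel Q Rep M).RespectsMoves := by
  have hM' : ∀ a : A, Rep (Q.D a) = M.val * Rep a * M⁻¹.val := by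
    rw [← show Q.U = Q.D from hQ]; exact hM
  refine ((matrixModel Q Rep M).isBalanced_of_matrix (P := kroneckerRep Rep Rep Q.ρ)
    (P' := kroneckerRep Rep Rep Q.ρ⁻¹.val) ?_ ?_ ?_ ?_ ?_ ?_).respectsMoves
  · intro a b c d
    exact tensorEntry_map Rep _ b a c d
  · intro a b c d
    exact tensorEntry_map Rep _ a b d c
  · rw [← map_mul, Units.mul_inv, map_one]
  · have := kroneckerRep_map Rep (Q.U : A →ₐ[k] A) (Q.U : A →ₐ[k] A) hM hM Q.ρ
    rw [Q.map_U] at this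
    exact this.symm
  · have := congrArg (kroneckerRep Rep (transposeRep Rep)) Q.op_inverse
    rw [map_mul, map_one, kroneckerRep_toOp, kroneckerRep_toOp,
      kroneckerRep_map Rep (AlgHom.id k A) (Q.U : A →ₐ[k] A) (m := 1) (m' := 1) (by simp) hM,
      kroneckerRep_map Rep (Q.D : A →ₐ[k] A) (AlgHom.id k A) (p := 1) (p' := 1) hM' (by simp)]
      at this
    exact this
  · have := congrArg (kroneckerRep Rep (kroneckerRep Rep Rep)) Q.yang_baxter
    simp only [map_mul, kroneckerRep_leg12, kroneckerRep_leg13, kroneckerRep_leg23] at this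
    exact this

end Image

section Range

variable {k : Type u} [CommRing k] {A : Type v} [Ring A] [Algebra k A] {B : Type*} [Ring B]
  [Algebra k B]

lemma map_leg12 (f : A →ₐ[k] B) (x : A ⊗[k] A) :
    Algebra.TensorProduct.map f (Algebra.TensorProduct.map f f) (leg12 k A x) =
      leg12 k B (Algebra.TensorProduct.map f f x) := by
  induction x with
  | zero => simp
  | tmul a b => simp [leg12]
  | add x y hx hy => simp only [map_add, hx, hy]

lemma map_leg13 (f : A →ₐ[k] B) (x : A ⊗[k] A) :
    Algebra.TensorProduct.map f (Algebra.TensorProduct.map f f) (leg13 k A x) =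
      leg13 k B (Algebra.TensorProduct.map f f x) := by
  induction x with
  | zero => simp
  | tmul a b => simp [leg13]
  | add x y hx hy => simp only [map_add, hx, hy]

lemma map_leg23 (f : A →ₐ[k] B) (x : A ⊗[k] A) :
    Algebra.TensorProduct.map f (Algebra.TensorProduct.map f f) (leg23 k A x) =
      leg23 k B (Algebra.TensorProduct.map f f x) := by
  induction x with
  | zero => simp
  | tmul a b => simp [leg23]
  | add x y hx hy => simp only [map_add, hx, hy]

lemma map_toOp (f : A →ₐ[k] B) (x : A ⊗[k] A) :
    Algebra.TensorProduct.map f f.op (toOp k A x) =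
      toOp k B (Algebra.TensorProduct.map f f x) := by
  induction x with
  | zero => simp
  | tmul a b => simp [toOp]
  | add x y hx hy => simp only [map_add, hx, hy]

lemma map_map_of_comm (f : A →ₐ[k] B) {S T : A →ₐ[k] A} {S' T' : B →ₐ[k] B}
    (hS : ∀ a, S' (f a) = f (S a)) (hT : ∀ a, T' (f a) = f (T a)) (x : A ⊗[k] A) :
    Algebra.TensorProduct.map S' T' (Algebra.TensorProduct.map f f x) =
      Algebra.TensorProduct.map f f (Algebra.TensorProduct.map S T x) := by
  induction x with
  | zero => simp
  | tmul a b => simp [hS, hT]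
  | add x y hx hy => simp only [map_add, hx, hy]

/-- The image of an oriented quantum algebra under an algebra homomorphism which intertwines the
automorphisms. -/
noncomputable def OrientedQuantumAlgebra.image (Q : OrientedQuantumAlgebra k A) (f : A →ₐ[k] B)
    (hf : Function.Surjective f) (D U : B ≃ₐ[k] B) (hD : ∀ a, D (f a) = f (Q.D a))
    (hU : ∀ a, U (f a) = f (Q.U a)) : OrientedQuantumAlgebra k B where
  ρ := Units.map (Algebra.TensorProduct.map f f : A ⊗[k] A →* B ⊗[k] B) Q.ρ
  D := D
  U := U
  yang_baxter := by
    have := congrArg (Algebra.TensorProduct.map f (Algebra.TensorProduct.map f f)) Q.yang_baxter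
    simp only [map_mul, map_leg12, map_leg13, map_leg23] at this
    exact this
  commute b := by
    obtain ⟨a, rfl⟩ := hf b
    rw [hU, hD, hD, hU, Q.commute]
  map_U := by
    have := map_map_of_comm f (S := Q.U) (T := Q.U) (S' := U) (T' := U) hU hU Q.ρ
    rw [Q.map_U] at this
    exact this
  map_D := by
    have := map_map_of_comm f (S := Q.D) (T := Q.D) (S' := D) (T' := D) hD hD Q.ρ
    rw [Q.map_D] at this
    exact this
  op_inverse := by
    have := congrArg (Algebra.TensorProduct.map f f.op) Q.op_inverse
    rw [map_mul, map_one, map_toOp, map_toOp,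
      ← map_map_of_comm f (S := AlgHom.id k A) (T := Q.U) (S' := AlgHom.id k B) (T' := U)
        (fun _ => rfl) hU,
      ← map_map_of_comm f (S := Q.D) (T := AlgHom.id k A) (S' := D) (T' := AlgHom.id k B)
        hD (fun _ => rfl)] at this
    exact this
  op_inverse' := by
    have := congrArg (Algebra.TensorProduct.map f f.op) Q.op_inverse'
    rw [map_mul, map_one, map_toOp, map_toOp,
      ← map_map_of_comm f (S := AlgHom.id k A) (T := Q.U) (S' := AlgHom.id k B) (T' := U)
        (fun _ => rfl) hU,
      ← map_map_of_comm f (S := Q.D) (T := AlgHom.id k A) (S' := D) (T' := AlgHom.id k B)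
        hD (fun _ => rfl)] at this
    exact this

variable {n : ℕ} (Rep : A →ₐ[k] Matrix (Fin n) (Fin n) k) (M : (Matrix (Fin n) (Fin n) k)ˣ)

/-- Conjugation by `M` on the image of `Rep`, when it lifts to an automorphism `T`. -/
noncomputable def rangeConj (T : A ≃ₐ[k] A)
    (hM : ∀ a : A, Rep (T a) = M.val * Rep a * M⁻¹.val) : Rep.range ≃ₐ[k] Rep.range where
  toFun x := ⟨M.val * x * M⁻¹.val, by
    obtain ⟨a, ha⟩ := x.2
    exact ⟨T a, by rw [← ha]; exact hM a⟩⟩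
  invFun x := ⟨M⁻¹.val * x * M.val, by
    obtain ⟨a, ha⟩ := x.2
    refine ⟨T.symm a, ?_⟩
    have h : Rep a = M.val * Rep (T.symm a) * M⁻¹.val := by rw [← hM, T.apply_symm_apply]
    rw [← ha]
    change Rep _ = M⁻¹.val * Rep a * M.val
    rw [h]
    simp [mul_assoc]⟩
  left_inv x := by ext1; simp [mul_assoc]
  right_inv x := by ext1; simp [mul_assoc]
  map_mul' x y := by ext1; simp [mul_assoc]
  map_add' x y := by ext1; simp [mul_add, add_mul]
  commutes' r := by
    ext1
    simp [← Algebra.commutes r M.val, mul_assoc]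

end Range

/-- The image of a balanced oriented quantum algebra under a representation in which its
automorphism is conjugation by `M`. -/
lemma exists_balanced_range {k : Type u} [CommRing k] {A : Type v} [Ring A] [Algebra k A]
    (Q : OrientedQuantumAlgebra k A) (hQ : Q.Balanced)
    {n : ℕ} (Rep : A →ₐ[k] Matrix (Fin n) (Fin n) k) (M : (Matrix (Fin n) (Fin n) k)ˣ)
    (hM : ∀ a : A, Rep (Q.U a) = M.val * Rep a * M⁻¹.val) :
    ∃ Q' : OrientedQuantumAlgebra k Rep.range, Q'.Balanced ∧
      (Q'.ρ : Rep.range ⊗[k] Rep.range) =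
        Algebra.TensorProduct.map Rep.rangeRestrict Rep.rangeRestrict (Q.ρ : A ⊗[k] A) ∧
      ∀ x : Rep.range, (Q'.U x : Matrix (Fin n) (Fin n) k) = M.val * x * M⁻¹.val := by
  have hU : ∀ a, rangeConj Rep M Q.U hM (Rep.rangeRestrict a) = Rep.rangeRestrict (Q.U a) :=
    fun a => Subtype.ext (hM a).symm
  refine ⟨Q.image Rep.rangeRestrict Rep.rangeRestrict_surjective (rangeConj Rep M Q.U hM)
    (rangeConj Rep M Q.U hM) (fun a => ?_) hU, rfl, rfl, fun x => rfl⟩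
  rw [hU, show Q.U = Q.D from hQ]

/-! ### Traces of products as sums over closed paths -/

section Trace

open Matrix

variable {ι : Type*} [Fintype ι] [DecidableEq ι] {k : Type u} [CommRing k]

lemma sum_fin_succ_pi {N : ℕ} {β : Type*} [Fintype β] (F : (Fin (N + 1) → β) → k) :
    ∑ g, F g = ∑ a, ∑ g : Fin N → β, F (Fin.cons a g) := by
  rw [← Fintype.sum_prod_type' (f := fun a (g : Fin N → β) => F (Fin.cons a g))]
  exact (Fintype.sum_equiv (Fin.consEquiv fun _ => β) _ _ fun _ => rfl).symm

lemma list_prod_apply_eq_sum (m : ℕ) (A : Fin (m + 1) → Matrix ι ι k) (x y : ι) :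
    (List.ofFn A).prod x y =
      ∑ g : Fin m → ι, ∏ i, A i ((Fin.cons x g : Fin (m + 1) → ι) i)
        ((Fin.snoc g y : Fin (m + 1) → ι) i) := by
  induction m generalizing x with
  | zero => simp [Fin.snoc]
  | succ m ih =>
    rw [List.ofFn_succ, List.prod_cons, mul_apply, sum_fin_succ_pi]
    refine Finset.sum_congr rfl fun z _ => ?_
    rw [ih, Finset.mul_sum]
    refine Finset.sum_congr rfl fun g _ => ?_
    rw [Fin.prod_univ_succ (n := m + 1)]
    simp only [← Fin.cons_snoc_eq_snoc_cons, Fin.cons_zero, Fin.cons_succ]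

lemma trace_list_prod (m : ℕ) (A : Fin (m + 1) → Matrix ι ι k) :
    trace (List.ofFn A).prod = ∑ g : Fin (m + 1) → ι, ∏ i, A i (g i) (g (i + 1)) := by
  rw [sum_fin_succ_pi]
  refine Finset.sum_congr rfl fun x _ => ?_
  rw [diag_apply, list_prod_apply_eq_sum]
  refine Finset.sum_congr rfl fun g _ => Finset.prod_congr rfl fun i _ => ?_
  congr 1
  induction i using Fin.lastCases with
  | last => simp
  | cast i => simp [Fin.coeSucc_eq_succ]

end Trace

/-! ### Colourings as functions of the arcs -/

section Arcs

/-- The number of arcs that leave the critical points of a word. -/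
def arcCount : Word → ℕ
  | [] => 0
  | (_, .cup _) :: w => arcCount w + 2
  | (_, .cap _) :: w => arcCount w
  | (_, .cross _ _ _) :: w => arcCount w + 2

variable {β : Type*}

/-- The marking by the values of a function on the numbers `m, m + 1, …`. -/
def markingOf (f : ℕ → β) : (w : Word) → ℕ → Marking β w
  | [], _ => PUnit.unit
  | (_, .cup _) :: w, m => (f m, f (m + 1), markingOf f w (m + 2))
  | (_, .cap _) :: w, m => markingOf f w m
  | (_, .cross _ _ _) :: w, m => (f m, f (m + 1), markingOf f w (m + 2))

/-- The marking by the values of a finite sequence. -/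
def markingOfFin : (w : Word) → (Fin (arcCount w) → β) → Marking β w
  | [], _ => PUnit.unit
  | (_, .cup _) :: w, g =>
    (g (0 : Fin (arcCount w + 2)), g (1 : Fin (arcCount w + 2)), markingOfFin w fun i => g i.succ.succ)
  | (_, .cap _) :: w, g => markingOfFin w g
  | (_, .cross _ _ _) :: w, g =>
    (g (0 : Fin (arcCount w + 2)), g (1 : Fin (arcCount w + 2)), markingOfFin w fun i => g i.succ.succ)

lemma sum_marking {k : Type*} [CommRing k] [Fintype β] (w : Word) (F : Marking β w → k) :
    ∑ χ, F χ = ∑ g : Fin (arcCount w) → β, F (markingOfFin w g) := by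
  induction w with
  | nil => exact (Fintype.sum_unique (ι := PUnit) F).trans (Fintype.sum_unique _).symm
  | cons x w ih =>
    obtain ⟨p, s | s | ⟨o, s, t⟩⟩ := x
    · refine (Fintype.sum_prod_type (α₁ := β) (α₂ := β × Marking β w) F).trans ?_
      refine Eq.trans ?_ (sum_fin_succ_pi (N := arcCount w + 1) _).symm
      simp only [Fintype.sum_prod_type, sum_fin_succ_pi]
      exact Finset.sum_congr rfl fun a _ => Finset.sum_congr rfl fun b _ =>
        ih fun χ => F (a, b, χ)
    · exact ih F
    · refine (Fintype.sum_prod_type (α₁ := β) (α₂ := β × Marking β w) F).trans ?_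
      refine Eq.trans ?_ (sum_fin_succ_pi (N := arcCount w + 1) _).symm
      simp only [Fintype.sum_prod_type, sum_fin_succ_pi]
      exact Finset.sum_congr rfl fun a _ => Finset.sum_congr rfl fun b _ =>
        ih fun χ => F (a, b, χ)

lemma markingOfFin_eq (f : ℕ → β) (w : Word) (m : ℕ) (g : Fin (arcCount w) → β)
    (h : ∀ i : Fin (arcCount w), f (m + i) = g i) : markingOfFin w g = markingOf f w m := by
  induction w generalizing m with
  | nil => rfl
  | cons x w ih =>
    obtain ⟨p, s | s | ⟨o, s, t⟩⟩ := x
    · refine Prod.ext (h (0 : Fin (arcCount w + 2))).symm (Prod.ext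
        (h (1 : Fin (arcCount w + 2))).symm (ih (m + 2) _ fun i => ?_))
      exact (congrArg f (by simp; omega)).trans
        (h (i.succ.succ : Fin (arcCount w + 2)))
    · exact ih m g h
    · refine Prod.ext (h (0 : Fin (arcCount w + 2))).symm (Prod.ext
        (h (1 : Fin (arcCount w + 2))).symm (ih (m + 2) _ fun i => ?_))
      exact (congrArg f (by simp; omega)).trans
        (h (i.succ.succ : Fin (arcCount w + 2)))

/-- Change of the marks of a critical point. -/
def CriticalPoint.map {γ : Type*} (f : γ → β) : CriticalPoint γ → CriticalPoint β
  | .cup s a b => .cup s (f a) (f b)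
  | .cap s a b => .cap s (f a) (f b)
  | .cross o s t a b c d => .cross o s t (f a) (f b) (f c) (f d)

lemma critical_markingOf (f : ℕ → β) (w : Word) (m : ℕ) (cur : List ℕ) :
    critical w (cur.map f) (markingOf f w m) =
      (critical w cur (numbering w m)).map (CriticalPoint.map f) := by
  induction w generalizing m cur with
  | nil => rfl
  | cons x w ih =>
    obtain ⟨p, s | s | ⟨o, s, t⟩⟩ := x
    · simp only [critical, markingOf, numbering, List.map_cons, CriticalPoint.map, ← ih,
        List.map_append, List.map_take, List.map_drop]
    · simp only [critical, markingOf, numbering, ← List.map_take, ← List.map_drop]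
      rcases cur.drop p with _ | ⟨a, _ | ⟨b, r⟩⟩
      · rfl
      · rfl
      · simp only [List.map_cons, CriticalPoint.map, ← ih, List.map_append]
    · simp only [critical, markingOf, numbering, ← List.map_take, ← List.map_drop]
      rcases cur.drop p with _ | ⟨a, _ | ⟨b, r⟩⟩
      · rfl
      · rfl
      · simp only [List.map_cons, CriticalPoint.map, ← ih, List.map_append]

/-- The entries of a list of arcs at which the list of signs has the value `t`. -/
def ends (t : Bool) : List ℕ → List Bool → Multiset ℕ
  | x :: cur, s :: a => (if s = t then {x} else 0) + ends t cur a
  | _, _ => 0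

lemma ends_append (t : Bool) (l r : List ℕ) (a b : List Bool) (h : l.length = a.length) :
    ends t (l ++ r) (a ++ b) = ends t l a + ends t r b := by
  induction l generalizing a with
  | nil =>
    obtain rfl : a = [] := List.length_eq_zero_iff.1 h.symm
    simp [ends]
  | cons x l ih =>
    obtain _ | ⟨s, a⟩ := a
    · simp at h
    · simp only [List.cons_append, ends, ih a (by simpa using h), add_assoc]

/-- Every arc is the incoming arc of exactly one strand, and the outgoing arc of exactly one. -/
lemma IsTangle.flow_perm {a b : List Bool} {w : Word} (h : IsTangle a w b) (hb : b = [])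
    (cur : List ℕ) (hc : cur.length = a.length) (m : ℕ) :
    ((((critical w cur (numbering w m)).flatMap CriticalPoint.flow).map Prod.fst : List ℕ) :
        Multiset ℕ) = ends true cur a + (List.range' m (arcCount w) : Multiset ℕ) ∧
    ((((critical w cur (numbering w m)).flatMap CriticalPoint.flow).map Prod.snd : List ℕ) :
        Multiset ℕ) = ends false cur a + (List.range' m (arcCount w) : Multiset ℕ) := by
  induction h generalizing cur m with
  | nil a =>
    subst hb
    obtain rfl : cur = [] := List.length_eq_zero_iff.1 hc
    simp [critical, ends, arcCount]
  | cons l r x w b h ih =>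
    obtain ⟨l', i, r', rfl, hl, hi⟩ := exists_append_of_le_length (l := cur) (p := l.length)
      (q := x.dom.length) (by simp [hc])
    have hr : r'.length = r.length := by simp at hc; omega
    rw [← hl]
    rcases x with s | s | ⟨o, s, t⟩
    · obtain rfl : i = [] := List.length_eq_zero_iff.1 hi
      have := ih hb (l' ++ [m, m + 1] ++ r') (by simp [hl, hr, Piece.cod]) (m + 2)
      have hcrit : critical ((l'.length, .cup s) :: w) (l' ++ [] ++ r') (numbering _ m) =
          .cup s m (m + 1) :: critical w (l' ++ [m, m + 1] ++ r') (numbering w (m + 2)) := by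
        simp [critical, numbering]
      simp only [hcrit, List.flatMap_cons, List.map_append, ← Multiset.coe_add, this, Piece.dom,
        Piece.cod, ends_append, hl, List.length_append, List.length_cons, List.length_nil]
      cases s <;>
      · simp [CriticalPoint.flow, ends, arcCount, List.range'_succ, ← Multiset.singleton_add,
          ← Multiset.cons_coe]
        constructor <;> abel
    · obtain ⟨c, d, rfl⟩ := List.length_eq_two.1 hi
      have := ih hb (l' ++ [] ++ r') (by simp [hl, hr, Piece.cod]) m
      have hcrit : critical ((l'.length, .cap s) :: w) (l' ++ [c, d] ++ r') (numbering _ m) =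
          .cap s c d :: critical w (l' ++ [] ++ r') (numbering w m) := by
        simp [critical, numbering]
      simp only [hcrit, List.flatMap_cons, List.map_append, ← Multiset.coe_add, this, Piece.dom,
        Piece.cod, ends_append, hl, List.length_append, List.length_cons, List.length_nil]
      cases s <;>
      · simp [CriticalPoint.flow, ends, arcCount, -Multiset.singleton_add]
        constructor <;> abel
    · obtain ⟨c, d, rfl⟩ := List.length_eq_two.1 hi
      have := ih hb (l' ++ [m, m + 1] ++ r') (by simp [hl, hr, Piece.cod]) (m + 2)
      have hcrit : critical ((l'.length, .cross o s t) :: w) (l' ++ [c, d] ++ r')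
          (numbering _ m) = .cross o s t m (m + 1) c d ::
            critical w (l' ++ [m, m + 1] ++ r') (numbering w (m + 2)) := by
        simp [critical, numbering]
      simp only [hcrit, List.flatMap_cons, List.map_append, ← Multiset.coe_add, this, Piece.dom,
        Piece.cod, ends_append, hl, List.length_append, List.length_cons, List.length_nil]
      cases s <;> cases t <;>
      · simp [CriticalPoint.flow, ends, arcCount, List.range'_succ, ← Multiset.singleton_add,
          ← Multiset.cons_coe]
        constructor <;> abel

end Arcs

/-! ### Following the strand of a closed loop -/

section Loop

variable {A : Type v}

/-- The strand of a decorated diagram that starts on the arc `j`. -/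
def strandAt (P : List ((ℕ × ℕ) × Letter A)) (j : ℕ) : (ℕ × ℕ) × Letter A :=
  (P.find? fun x => x.1.1 == j).getD ((0, 0), .turn true)

/-- The decorated strands of a closed loop with `N` arcs. -/
structure IsDecoratedLoop (P : List ((ℕ × ℕ) × Letter A)) (N : ℕ) : Prop where
  fst_perm : (P.map fun x => x.1.1).Perm (List.range N)
  snd_perm : (P.map fun x => x.1.2).Perm (List.range N)
  reach : ∀ x ∈ P, ∀ y ∈ P,
    Relation.ReflTransGen (fun a b => (a, b) ∈ P.map Prod.fst) x.1.1 y.1.1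

namespace IsDecoratedLoop

variable {P : List ((ℕ × ℕ) × Letter A)} {N : ℕ} (h : IsDecoratedLoop P N)

include h

lemma find?_eq {y : (ℕ × ℕ) × Letter A} (hy : y ∈ P) :
    (P.find? fun x => x.1.1 == y.1.1) = some y := by
  have hn : (P.map fun x => x.1.1).Nodup := h.fst_perm.nodup_iff.2 List.nodup_range
  obtain ⟨z, hz⟩ : ∃ z, (P.find? fun x => x.1.1 == y.1.1) = some z :=
    Option.isSome_iff_exists.1 (List.find?_isSome.2 ⟨y, hy, by simp⟩)
  have hz1 : z.1.1 = y.1.1 := by simpa using List.find?_some hz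
  rw [hz, List.inj_on_of_nodup_map hn (List.mem_of_find?_eq_some hz) hy hz1]

lemma strandAt_eq {y : (ℕ × ℕ) × Letter A} (hy : y ∈ P) : strandAt P y.1.1 = y := by
  rw [strandAt, h.find?_eq hy, Option.getD_some]

lemma strandAt_mem {j : ℕ} (hj : j < N) : strandAt P j ∈ P ∧ (strandAt P j).1.1 = j := by
  have : j ∈ P.map fun x => x.1.1 := h.fst_perm.mem_iff.2 (List.mem_range.2 hj)
  obtain ⟨y, hy, rfl⟩ := List.mem_map.1 this
  rw [h.strandAt_eq hy]
  exact ⟨hy, rfl⟩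

lemma next_lt {j : ℕ} (hj : j < N) : (strandAt P j).1.2 < N :=
  List.mem_range.1 (h.snd_perm.mem_iff.1 (List.mem_map.2 ⟨_, (h.strandAt_mem hj).1, rfl⟩))

lemma perm_strandAt : P.Perm ((List.range N).map (strandAt P)) := by
  have : P = (P.map fun x => x.1.1).map (strandAt P) := by
    rw [List.map_map]
    exact (List.map_id P).symm.trans (List.map_congr_left fun y hy => (h.strandAt_eq hy).symm)
  conv_lhs => rw [this]
  exact h.fst_perm.map _

lemma next_surjective : Function.Surjective fun j : Fin N => (⟨(strandAt P j).1.2, h.next_lt j.2⟩ :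
    Fin N) := by
  intro i
  have : i.1 ∈ P.map fun x => x.1.2 := h.snd_perm.mem_iff.2 (List.mem_range.2 i.2)
  obtain ⟨y, hy, hi⟩ := List.mem_map.1 this
  have hj : y.1.1 < N :=
    List.mem_range.1 (h.fst_perm.mem_iff.1 (List.mem_map.2 ⟨_, hy, rfl⟩))
  exact ⟨⟨y.1.1, hj⟩, Fin.ext (by simp [h.strandAt_eq hy, hi])⟩

/-- The permutation which maps an arc to the next one along the orientation. -/
noncomputable def next : Equiv.Perm (Fin N) :=
  Equiv.ofBijective _ (Finite.injective_iff_bijective.1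
    (Finite.injective_iff_surjective.2 h.next_surjective))

lemma next_apply (j : Fin N) : ((h.next j : Fin N) : ℕ) = (strandAt P j).1.2 := rfl

lemma isCycleOn_next : h.next.IsCycleOn ((Finset.univ : Finset (Fin N)) : Set (Fin N)) := by
  refine ⟨by simp, fun i _ j _ => ?_⟩
  have hr := h.reach _ (h.strandAt_mem i.2).1 _ (h.strandAt_mem j.2).1
  rw [(h.strandAt_mem i.2).2, (h.strandAt_mem j.2).2] at hr
  have key : ∀ b : ℕ, Relation.ReflTransGen (fun a b => (a, b) ∈ P.map Prod.fst) i b →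
      ∃ m : ℕ, (((h.next ^ m) i : Fin N) : ℕ) = b := by
    intro b hb
    induction hb with
    | refl => exact ⟨0, rfl⟩
    | @tail b c _ hbc ih =>
      obtain ⟨m, hm⟩ := ih
      obtain ⟨y, hy, hbc⟩ := List.mem_map.1 hbc
      refine ⟨m + 1, ?_⟩
      rw [pow_succ', Equiv.Perm.mul_apply, next_apply, hm, show b = y.1.1 by rw [hbc],
        h.strandAt_eq hy, hbc]
  obtain ⟨m, hm⟩ := key _ hr
  exact ⟨m, by rw [zpow_natCast]; exact Fin.ext hm⟩

lemma walk_eq (m : ℕ) (a : Fin N) :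
    walk P m a = List.ofFn fun i : Fin m => (strandAt P ((h.next ^ (i : ℕ)) a)).2 := by
  induction m generalizing a with
  | zero => simp [walk]
  | succ m ih =>
    obtain ⟨h1, h2⟩ := h.strandAt_mem a.2
    have h3 := h.find?_eq h1
    rw [h2] at h3
    simp only [walk, h3, List.ofFn_succ]
    rw [← h.next_apply, ih]
    simp [pow_succ]

/-- The arcs in the order in which one meets them from `a` on. -/
noncomputable def arcOrder (a : Fin N) : Fin N ≃ Fin N :=
  Equiv.ofBijective (fun i => (h.next ^ (i : ℕ)) a) (Finite.injective_iff_bijective.1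
    (Finite.injective_iff_surjective.2 fun j => by
      obtain ⟨m, hm, hj⟩ := h.isCycleOn_next.exists_pow_eq (Finset.mem_univ a) (Finset.mem_univ j)
      exact ⟨⟨m, by simpa using hm⟩, hj⟩))

lemma arcOrder_apply (a i : Fin N) : h.arcOrder a i = (h.next ^ (i : ℕ)) a := rfl

lemma walk_perm (a : Fin N) : (walk P N a).Perm (P.map Prod.snd) := by
  refine List.Perm.trans ?_ (h.perm_strandAt.map Prod.snd).symm
  rw [h.walk_eq, List.map_map]
  have h1 : (List.ofFn fun i : Fin N => (strandAt P ((h.next ^ (i : ℕ)) a)).2) =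
      List.ofFn ((fun j : Fin N => (strandAt P j).2) ∘ h.arcOrder a) := rfl
  rw [h1]
  refine (Equiv.Perm.ofFn_comp_perm (h.arcOrder a) _).trans (List.Perm.of_eq ?_)
  rw [List.ofFn_eq_map, ← List.map_coe_finRange_eq_range, List.map_map]
  rfl

end IsDecoratedLoop

lemma IsDecoratedLoop.arcOrder_add_one {P : List ((ℕ × ℕ) × Letter A)} {m : ℕ} (h : IsDecoratedLoop P (m + 1)) (a i : Fin (m + 1)) :
    h.arcOrder a (i + 1) = h.next (h.arcOrder a i) := by
  rw [h.arcOrder_apply, h.arcOrder_apply, ← Equiv.Perm.mul_apply, ← pow_succ']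
  induction i using Fin.lastCases with
  | last =>
    have := h.isCycleOn_next.pow_card_apply (Finset.mem_univ a)
    rw [Finset.card_fin] at this
    rw [Fin.last_add_one, Fin.val_last, this]
    rfl
  | cast i => rw [Fin.coeSucc_eq_succ]; rfl

/-- The state sum of a decorated closed loop is the trace of the product along its strand. -/
lemma IsDecoratedLoop.sum_eq_trace {P : List ((ℕ × ℕ) × Letter A)} {N : ℕ}
    (h : IsDecoratedLoop P N) {ι : Type*} [Fintype ι] [DecidableEq ι] {k : Type u} [CommRing k]
    (F : Letter A → Matrix ι ι k) (ext : (Fin N → ι) → ℕ → ι)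
    (hext : ∀ g (i : Fin N), ext g i = g i) (a : Fin N) :
    ∑ g : Fin N → ι, (P.map fun x => F x.2 (ext g x.1.1) (ext g x.1.2)).prod =
      Matrix.trace ((walk P N a).map F).prod := by
  obtain _ | m := N
  · exact a.elim0
  rw [h.walk_eq, List.map_ofFn, trace_list_prod]
  refine (Fintype.sum_equiv (Equiv.arrowCongr (h.arcOrder a) (Equiv.refl ι)) _ _ fun g => ?_).symm
  have hprod (G : ℕ → k) : ((List.range (m + 1)).map G).prod = ∏ j : Fin (m + 1), G j := by
    rw [← Finset.prod_range]; rfl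
  rw [(h.perm_strandAt.map _).prod_eq, List.map_map, hprod]
  conv_rhs => rw [← Equiv.prod_comp (h.arcOrder a)]
  refine Finset.prod_congr rfl fun i _ => ?_
  simp only [Function.comp_apply, (h.strandAt_mem (h.arcOrder a i).2).2, ← h.next_apply, hext,
    ← h.arcOrder_add_one, Equiv.arrowCongr_apply, Equiv.symm_apply_apply, Equiv.refl_apply]
  rfl

end Loop

/-! ### The matrix model on a closed loop -/

section Evaluation

open Matrix
open scoped Kronecker

/-- The half turn of a letter. -/
def Letter.halfTurns {A : Type v} : Letter A → ℤ
  | .turn s => if s then 1 else -1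
  | .bead _ => 0

/-- The half turn at a critical point. -/
def CriticalPoint.halfTurns {β : Type*} : CriticalPoint β → ℤ
  | .cup s _ _ => if s then 1 else -1
  | .cap s _ _ => if s then 1 else -1
  | .cross _ _ _ _ _ _ _ => 0

section Decoration

variable {k : Type u} [CommRing k] {A : Type v} [Ring A] [Algebra k A] {I : Type}
  (T : A ≃ₐ[k] A) (e e' E E' : I → A)

lemma map_fst_decorate (L : List (CriticalPoint ℕ)) (f : Labels I L) :
    (decorate T e e' E E' L f).map Prod.fst = L.flatMap CriticalPoint.flow := by
  induction L with
  | nil => rfl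
  | cons x L ih =>
    obtain ⟨s, a, b⟩ | ⟨s, a, b⟩ | ⟨o, s, t, a, b, c, d⟩ := x
    · simpa [decorate, CriticalPoint.flow] using ih f
    · simpa [decorate, CriticalPoint.flow] using ih f
    · obtain ⟨i, f⟩ := f
      simpa [decorate, CriticalPoint.flow] using ih f

lemma sum_halfTurns_decorate (L : List (CriticalPoint ℕ)) (f : Labels I L) :
    ((decorate T e e' E E' L f).map fun x => x.2.halfTurns).sum =
      (L.map CriticalPoint.halfTurns).sum := by
  induction L with
  | nil => rfl
  | cons x L ih =>
    obtain ⟨s, a, b⟩ | ⟨s, a, b⟩ | ⟨o, s, t, a, b, c, d⟩ := x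
    · simpa [decorate, CriticalPoint.flow, Letter.halfTurns, CriticalPoint.halfTurns] using ih f
    · simpa [decorate, CriticalPoint.flow, Letter.halfTurns, CriticalPoint.halfTurns] using ih f
    · obtain ⟨i, f⟩ := f
      simpa [decorate, CriticalPoint.flow, Letter.halfTurns, CriticalPoint.halfTurns] using ih f

end Decoration

lemma IsTangle.sum_halfTurns_critical {a b : List Bool} {w : Word} (h : IsTangle a w b)
    (cur : List ℕ) (hc : cur.length = a.length) (m : ℕ) :
    ((critical w cur (numbering w m)).map CriticalPoint.halfTurns).sum =
      (w.map fun x => x.2.halfTurns).sum := by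
  induction h generalizing cur m with
  | nil a => rfl
  | cons l r x w b h ih =>
    obtain ⟨l', i, r', rfl, hl, hi⟩ := exists_append_of_le_length (l := cur) (p := l.length)
      (q := x.dom.length) (by simp [hc])
    have hr : r'.length = r.length := by simp at hc; omega
    rw [← hl]
    rcases x with s | s | ⟨o, s, t⟩
    · obtain rfl : i = [] := List.length_eq_zero_iff.1 hi
      have := ih (l' ++ [m, m + 1] ++ r') (by simp [hl, hr, Piece.cod]) (m + 2)
      simpa [critical, numbering, CriticalPoint.halfTurns, Piece.halfTurns] using this
    · obtain ⟨c, d, rfl⟩ := List.length_eq_two.1 hi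
      have := ih (l' ++ [] ++ r') (by simp [hl, hr, Piece.cod]) m
      simpa [critical, numbering, CriticalPoint.halfTurns, Piece.halfTurns] using this
    · obtain ⟨c, d, rfl⟩ := List.length_eq_two.1 hi
      have := ih (l' ++ [m, m + 1] ++ r') (by simp [hl, hr, Piece.cod]) (m + 2)
      simpa [critical, numbering, CriticalPoint.halfTurns, Piece.halfTurns] using this

lemma IsTangle.exists_halfTurns {a b : List Bool} {w : Word} (h : IsTangle a w b) :
    ∃ d : ℤ, (b.length : ℤ) = a.length + 2 * (w.map fun x => x.2.halfTurns).sum + 4 * d := by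
  induction h with
  | nil a => exact ⟨0, by simp⟩
  | cons l r x w b h ih =>
    obtain ⟨d, hd⟩ := ih
    rcases x with s | s | ⟨o, s, t⟩
    · cases s
      · refine ⟨d + 1, ?_⟩
        simp [hd, Piece.dom, Piece.cod, Piece.halfTurns]; ring
      · refine ⟨d, ?_⟩
        simp [hd, Piece.dom, Piece.cod, Piece.halfTurns]; ring
    · cases s
      · refine ⟨d, ?_⟩
        simp [hd, Piece.dom, Piece.cod, Piece.halfTurns]; ring
      · refine ⟨d - 1, ?_⟩
        simp [hd, Piece.dom, Piece.cod, Piece.halfTurns]; ring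
    · refine ⟨d, ?_⟩
      simp [hd, Piece.dom, Piece.cod, Piece.halfTurns]

/-- The Whitney degree of a link diagram is an integer. -/
lemma LinkDiagram.exists_halfTurns_eq (K : LinkDiagram) : ∃ d : ℤ, K.halfTurns = 2 * d := by
  obtain ⟨d, hd⟩ := K.closed.exists_halfTurns
  refine ⟨-d, ?_⟩
  simp only [List.length_nil, Nat.cast_zero, zero_add] at hd
  unfold LinkDiagram.halfTurns
  omega

section Model

variable {k : Type u} [CommRing k] {A : Type v} [Ring A] [Algebra k A]
  (Q : OrientedQuantumAlgebra k A) {n : ℕ} (Rep : A →ₐ[k] Matrix (Fin n) (Fin n) k)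
  (M : (Matrix (Fin n) (Fin n) k)ˣ)

/-- The matrix of a letter. -/
def letterMatrix : Letter A → Matrix (Fin n) (Fin n) k
  | .turn true => M.val
  | .turn false => M⁻¹.val
  | .bead a => Rep a

lemma Rep_slide_mul (T : A ≃ₐ[k] A) (hM : ∀ a : A, Rep (T a) = M.val * Rep a * M⁻¹.val)
    (L : List (Letter A)) :
    Rep (slide T L) * (M ^ (L.map Letter.halfTurns).sum).val =
      (L.map (letterMatrix Rep M)).prod := by
  have hM' (a : A) : Rep (T.symm a) = M⁻¹.val * Rep a * M.val := by
    have h : Rep a = M.val * Rep (T.symm a) * M⁻¹.val := by rw [← hM, T.apply_symm_apply]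
    rw [h]
    simp [mul_assoc]
  induction L with
  | nil => simp [slide]
  | cons x L ih =>
    rcases x with (_ | _) | a
    · simp only [slide, List.map_cons, List.prod_cons, letterMatrix, Letter.halfTurns,
        List.sum_cons, hM', ← ih, _root_.zpow_add, Units.val_mul]
      simp [mul_assoc]
    · simp only [slide, List.map_cons, List.prod_cons, letterMatrix, Letter.halfTurns,
        List.sum_cons, hM, ← ih, _root_.zpow_add, Units.val_mul]
      simp [mul_assoc]
    · simp only [slide, List.map_cons, List.prod_cons, letterMatrix, Letter.halfTurns,
        List.sum_cons, zero_add, map_mul, ← ih, mul_assoc]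

variable {I : Type} [Fintype I] {e e' E E' : I → A}

lemma cross_eq_sum_beads (T : A ≃ₐ[k] A) (hM : ∀ a : A, Rep (T a) = M.val * Rep a * M⁻¹.val)
    (hρ : ∑ i, e i ⊗ₜ[k] e' i = (Q.ρ : A ⊗[k] A))
    (hρ' : ∑ i, E i ⊗ₜ[k] E' i = ((Q.ρ⁻¹ : (A ⊗[k] A)ˣ) : A ⊗[k] A))
    (o s t : Bool) (a b c d : Fin n) :
    (matrixModel Q Rep M).cross o s t a b c d =
      ∑ i, Rep (crossingBeads T (e i) (e' i) (E i) (E' i) o s t).1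
          (if s then c else b) (if s then b else c) *
        Rep (crossingBeads T (e i) (e' i) (E i) (E' i) o s t).2
          (if t then d else a) (if t then a else d) := by
  have hR (a b c d : Fin n) :
      (matrixModel Q Rep M).R a b c d = ∑ i, Rep (e i) c b * Rep (e' i) d a := by
    rw [show (matrixModel Q Rep M).R a b c d = _ from tensorEntry_map Rep _ b a c d, ← hρ,
      map_sum, Matrix.sum_apply]
    simp
  have hS (a b c d : Fin n) :
      (matrixModel Q Rep M).S a b c d = ∑ i, Rep (E i) d a * Rep (E' i) c b := by
    rw [show (matrixModel Q Rep M).S a b c d = _ from tensorEntry_map Rep _ a b d c, ← hρ',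
      map_sum, Matrix.sum_apply]
    simp
  have hconj (X : I → Matrix (Fin n) (Fin n) k) (y : I → k) (N N' : Matrix (Fin n) (Fin n) k)
      (p q : Fin n) : ∑ i, (N * X i * N') p q * y i =
        ∑ l, ∑ j, N p j * (∑ i, X i j l * y i) * N' l q := by
    simp only [mul_apply, Finset.sum_mul, Finset.mul_sum]
    rw [Finset.sum_comm]
    refine Finset.sum_congr rfl fun l _ => ?_
    rw [Finset.sum_comm]
    exact Finset.sum_congr rfl fun _ _ => Finset.sum_congr rfl fun _ _ => by ring
  cases o <;> cases s <;> cases t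
  · simp [MatrixModel.cross, crossingBeads, hS, mul_comm]
  · simp only [MatrixModel.cross, crossingBeads, hR, MatrixModel.cap, MatrixModel.cup]
    simp only [BEq.rfl, Bool.false_beq, Bool.not_true, if_true, Bool.false_eq_true, if_false, hM, hconj]
    exact Finset.sum_congr rfl fun _ _ => Finset.sum_congr rfl fun _ _ => by
      simp only [Finset.mul_sum, Finset.sum_mul]
      exact Finset.sum_congr rfl fun _ _ => by dsimp only [matrixModel]; ring
  · simp only [MatrixModel.cross, crossingBeads, hR, MatrixModel.cap, MatrixModel.cup]
    simp only [BEq.rfl, Bool.true_beq, if_true, Bool.false_eq_true, if_false, hM, hconj]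
    rw [Finset.sum_comm]
    exact Finset.sum_congr rfl fun _ _ => Finset.sum_congr rfl fun _ _ => by
      simp only [Finset.mul_sum, Finset.sum_mul]
      exact Finset.sum_congr rfl fun _ _ => by dsimp only [matrixModel]; ring
  · simp [MatrixModel.cross, crossingBeads, hS, mul_comm]
  · simp [MatrixModel.cross, crossingBeads, hR]
  · simp only [MatrixModel.cross, crossingBeads, hS, MatrixModel.cap, MatrixModel.cup]
    simp only [Bool.false_beq, Bool.true_beq, Bool.not_true, if_true, Bool.false_eq_true, if_false, hM, hconj]
    exact Finset.sum_congr rfl fun _ _ => Finset.sum_congr rfl fun _ _ => by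
      simp only [Finset.mul_sum, Finset.sum_mul]
      exact Finset.sum_congr rfl fun _ _ => by dsimp only [matrixModel]; ring
  · simp only [MatrixModel.cross, crossingBeads, hS, MatrixModel.cap, MatrixModel.cup]
    simp only [Bool.true_beq, if_true, Bool.false_eq_true, if_false, hM, hconj]
    rw [Finset.sum_comm]
    exact Finset.sum_congr rfl fun _ _ => Finset.sum_congr rfl fun _ _ => by
      simp only [Finset.mul_sum, Finset.sum_mul]
      exact Finset.sum_congr rfl fun _ _ => by dsimp only [matrixModel]
  · simp [MatrixModel.cross, crossingBeads, hR]

lemma prod_weight_eq_sum (T : A ≃ₐ[k] A) (hM : ∀ a : A, Rep (T a) = M.val * Rep a * M⁻¹.val)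
    (hρ : ∑ i, e i ⊗ₜ[k] e' i = (Q.ρ : A ⊗[k] A))
    (hρ' : ∑ i, E i ⊗ₜ[k] E' i = ((Q.ρ⁻¹ : (A ⊗[k] A)ˣ) : A ⊗[k] A))
    (χ : ℕ → Fin n) (L : List (CriticalPoint ℕ)) :
    ((L.map (CriticalPoint.map χ)).map (matrixModel Q Rep M).weight).prod =
      ∑ f : Labels I L, ((decorate T e e' E E' L f).map fun x =>
        letterMatrix Rep M x.2 (χ x.1.1) (χ x.1.2)).prod := by
  induction L with
  | nil => exact (Fintype.sum_unique (ι := Unit) fun _ => (1 : k)).symm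
  | cons x L ih =>
    obtain ⟨s, a, b⟩ | ⟨s, a, b⟩ | ⟨o, s, t, a, b, c, d⟩ := x
    · change _ = ∑ f : Labels I L, _
      simp only [List.map_cons, List.prod_cons, ih, Finset.mul_sum]
      refine Finset.sum_congr rfl fun f _ => ?_
      cases s <;> rfl
    · change _ = ∑ f : Labels I L, _
      simp only [List.map_cons, List.prod_cons, ih, Finset.mul_sum]
      refine Finset.sum_congr rfl fun f _ => ?_
      cases s <;> rfl
    · refine Eq.trans ?_ (Fintype.sum_prod_type (α₁ := I) (α₂ := Labels I L) _).symm
      simp only [List.map_cons, List.prod_cons, ih, CriticalPoint.map, MatrixModel.weight,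
        cross_eq_sum_beads Q Rep M T hM hρ hρ', Finset.sum_mul, Finset.mul_sum]
      rw [Finset.sum_comm]
      refine Finset.sum_congr rfl fun i _ => Finset.sum_congr rfl fun f _ => ?_
      simp only [decorate, CriticalPoint.flow, List.zip_cons_cons, List.zip_nil_left,
        List.map_append, List.map_cons, List.map_nil, List.prod_append, List.prod_cons,
        List.prod_nil, mul_one, letterMatrix]
      cases s <;> cases t <;> rfl

/-- The matrix model of a closed loop is the trace of the bead word times a power of `M`. -/
lemma Z_eq_trace (hM : ∀ a : A, Rep (Q.U a) = M.val * Rep a * M⁻¹.val) {K : LinkDiagram}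
    (hK : K.IsLoop) {a : ℕ} (ha : a ∈ K.flow.map Prod.fst)
    (hρ : ∑ i, e i ⊗ₜ[k] e' i = (Q.ρ : A ⊗[k] A))
    (hρ' : ∑ i, E i ⊗ₜ[k] E' i = ((Q.ρ⁻¹ : (A ⊗[k] A)ˣ) : A ⊗[k] A)) :
    (matrixModel Q Rep M).Z K =
      trace ((M ^ K.halfTurns).val * Rep (K.beadWord Q.U e e' E E' a)) := by
  obtain ⟨hf1, hf2⟩ := K.closed.flow_perm rfl [] rfl 0
  set N := arcCount K.word
  replace hf1 : (K.flow.map Prod.fst).Perm (List.range N) := by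
    rw [← Multiset.coe_eq_coe, List.range_eq_range']
    change ((K.flow.map Prod.fst : List ℕ) : Multiset ℕ) = _ at hf1
    simpa only [ends, zero_add] using hf1
  replace hf2 : (K.flow.map Prod.snd).Perm (List.range N) := by
    rw [← Multiset.coe_eq_coe, List.range_eq_range']
    change ((K.flow.map Prod.snd : List ℕ) : Multiset ℕ) = _ at hf2
    simpa only [ends, zero_add] using hf2
  have hN : K.flow.length = N := by simpa using hf1.length_eq
  have haN : a < N := List.mem_range.1 (hf1.mem_iff.1 ha)
  have hloop (f : Labels I K.points) : IsDecoratedLoop (decorate Q.U e e' E E' K.points f) N := by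
    have hP : (decorate Q.U e e' E E' K.points f).map Prod.fst = K.flow :=
      map_fst_decorate Q.U e e' E E' K.points f
    refine ⟨?_, ?_, fun x hx y hy => ?_⟩
    · rw [← hP, List.map_map] at hf1; exact hf1
    · rw [← hP, List.map_map] at hf2; exact hf2
    · rw [hP]
      exact hK.2 _ (hP ▸ List.mem_map_of_mem hx) _ (hP ▸ List.mem_map_of_mem hy)
  have hterm (f : Labels I K.points) : ((walk (decorate Q.U e e' E E' K.points f) N a).map
      (letterMatrix Rep M)).prod = Rep (slide Q.U (walk (decorate Q.U e e' E E' K.points f)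
        N a)) * (M ^ K.halfTurns).val := by
    rw [← Rep_slide_mul Rep M Q.U hM]
    have h1 := (((hloop f).walk_perm ⟨a, haN⟩).map Letter.halfTurns).sum_eq
    rw [List.map_map] at h1
    have h2 : ((decorate Q.U e e' E E' K.points f).map (Letter.halfTurns ∘ Prod.snd)).sum =
        K.halfTurns := (sum_halfTurns_decorate Q.U e e' E E' K.points f).trans
      (K.closed.sum_halfTurns_critical [] rfl 0)
    rw [h1, h2]
  obtain _ | n := n
  · have h0 : (matrixModel Q Rep M).Z K = 0 := by
      rw [MatrixModel.Z, sum_marking]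
      have : IsEmpty (Fin (arcCount K.word) → Fin 0) := ⟨fun g => (g ⟨a, haN⟩).elim0⟩
      exact Fintype.sum_empty _
    rw [h0]
    simp [trace]
  · let ext (g : Fin N → Fin (n + 1)) (j : ℕ) : Fin (n + 1) := if h : j < N then g ⟨j, h⟩ else 0
    have hext (g : Fin N → Fin (n + 1)) (i : Fin N) : ext g i = g i := by simp [ext]
    calc (matrixModel Q Rep M).Z K
        = ∑ g : Fin N → Fin (n + 1), ∑ f : Labels I K.points,
            ((decorate Q.U e e' E E' K.points f).map fun x =>
              letterMatrix Rep M x.2 (ext g x.1.1) (ext g x.1.2)).prod := by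
          rw [MatrixModel.Z, sum_marking]
          refine Finset.sum_congr rfl fun g _ => ?_
          rw [markingOfFin_eq (ext g) K.word 0 g (fun i => by rw [zero_add]; exact hext g i),
            ← prod_weight_eq_sum Q Rep M Q.U hM hρ hρ' (ext g) K.points]
          rw [LinkDiagram.points, ← critical_markingOf]
          rfl
      _ = ∑ f : Labels I K.points, trace ((walk (decorate Q.U e e' E E' K.points f) N a).map
            (letterMatrix Rep M)).prod := by
          rw [Finset.sum_comm]
          exact Finset.sum_congr rfl fun f _ =>
            (hloop f).sum_eq_trace (letterMatrix Rep M) ext hext ⟨a, haN⟩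
      _ = _ := by
          simp only [hterm, LinkDiagram.beadWord, hN, map_sum, Finset.mul_sum, trace_sum]
          exact Finset.sum_congr rfl fun f _ => trace_mul_comm _ _

end Model

end Evaluation

end OQA

theorem mainTheorem2 {k : Type u} [CommRing k] {A : Type v} [Ring A] [Algebra k A]
    (Q : OQA.OrientedQuantumAlgebra k A) (hQ : Q.Balanced)
    {n : ℕ} (Rep : A →ₐ[k] Matrix (Fin n) (Fin n) k)
    (M : (Matrix (Fin n) (Fin n) k)ˣ)
    (hM : ∀ a : A, Rep (Q.U a) = M.val * Rep a * M⁻¹.val) :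
    -- `τ(x) = M x M⁻¹` and `Rep(ρ)` make `Rep(A)` a balanced oriented quantum algebra
    (∃ Q' : OQA.OrientedQuantumAlgebra k Rep.range, Q'.Balanced ∧
      (Q'.ρ : Rep.range ⊗[k] Rep.range) =
        Algebra.TensorProduct.map Rep.rangeRestrict Rep.rangeRestrict (Q.ρ : A ⊗[k] A) ∧
      ∀ x : Rep.range, (Q'.U x : Matrix (Fin n) (Fin n) k) = M.val * x * M⁻¹.val) ∧
    -- the matrix model is an invariant of regular isotopy of oriented links
    (∀ K K' : OQA.LinkDiagram, K.RegularIsotopic K' →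
      (OQA.matrixModel Q Rep M).Z K = (OQA.matrixModel Q Rep M).Z K') ∧
    -- its value on a closed loop with all beads slid to the arc `a`
    (∀ K : OQA.LinkDiagram, K.IsLoop → ∀ a ∈ K.flow.map Prod.fst,
      ∀ (I : Type) [Fintype I] (e e' E E' : I → A),
      ∑ i, e i ⊗ₜ[k] e' i = (Q.ρ : A ⊗[k] A) →
      ∑ i, E i ⊗ₜ[k] E' i = ((Q.ρ⁻¹ : (A ⊗[k] A)ˣ) : A ⊗[k] A) →
      ∃ d : ℤ, K.halfTurns = 2 * d ∧
        (OQA.matrixModel Q Rep M).Z K =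
          Matrix.trace (((M ^ 2) ^ d).val * Rep (K.beadWord Q.U e e' E E' a))) := by
  refine ⟨OQA.exists_balanced_range Q hQ Rep M hM, fun K K' h =>
    (OQA.respectsMoves_matrixModel Q Rep M hQ hM).Z_eq_of_regularIsotopic h,
    fun K hK a ha I _ e e' E E' hρ hρ' => ?_⟩
  obtain ⟨d, hd⟩ := K.exists_halfTurns_eq
  refine ⟨d, hd, ?_⟩
  rw [OQA.Z_eq_trace Q Rep M hM hK ha hρ hρ', hd, zpow_mul]
  rfl
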